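/- Let $n\ge 1$ and let $X^n$ be an essential compact $n$-dimensional polyhedral length space, that is, a metric space which is homeomorphic to the underlying space of a finite $n$-dimensional simplicial complex and whose distance is a length metric: the distance between any two points equals the infimum of the lengths of the paths joining them (so $X^n$ is path-connected). Here $X^n$ is called essential if there is no continuous map $f$ from $X^n$ to a CW complex $K$ of type $K(\pi_1(X^n),1)$ such that $f$ induces an isomorphism of fundamental groups and the image of $f$ is contained in the $(n-1)$-skeleton of $K$. Let $sys_1(X^n)$ be the infimum of the lengths of non-contractible closed curves in $X^n$, and let $UR_{n-1}(X^n)$ (the $(n-1)$-dimensional Alexandrov width) be the infimum of all $r\ge 0$ such that $X^n$ has a cover by connected open sets, each contained in a metric ball of radius $r$, with no $n+1$ distinct sets of the cover having a common point. Then $$sys_1(X^n)\le 2\,UR_{n-1}(X^n).$$ -/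

import Mathlib

open scoped ENNReal NNReal

universe u

/-- `X` is a compact `n`-dimensional polyhedron: it is homeomorphic to the underlying space of a
finite simplicial complex in some Euclidean space, all of whose simplices have dimension at most
`n` (at most `n + 1` vertices) and one of whose simplices has dimension exactly `n`. -/
def IsCompactPolyhedron (X : Type u) [TopologicalSpace X] (n : ℕ) : Prop :=
  ∃ (N : ℕ) (K : Geometry.SimplicialComplex ℝ (EuclideanSpace ℝ (Fin N))),
    K.faces.Finite ∧ (∀ s ∈ K.faces, s.card ≤ n + 1) ∧ (∃ s ∈ K.faces, s.card = n + 1) ∧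
      Nonempty (X ≃ₜ K.space)

/-- The length of a path: the supremum of the lengths of inscribed polygons (possibly `∞`). -/
noncomputable def pathLength {X : Type u} [PseudoEMetricSpace X] {x y : X} (γ : Path x y) : ℝ≥0∞ :=
  eVariationOn (fun t => γ t) Set.univ

/-- A length space: the distance of two points is the infimum of the lengths of the paths that
connect them. (In a metric space distances are finite, so any two points are then connected by
a path.) -/
def IsLengthSpace (X : Type u) [PseudoEMetricSpace X] : Prop :=
  ∀ x y : X, edist x y = ⨅ γ : Path x y, pathLength γ

/-- The systole `sys₁(X)`: the infimum of the lengths of the non-contractible closed curves. -/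
noncomputable def systole (X : Type u) [PseudoEMetricSpace X] : ℝ≥0∞ :=
  ⨅ (x : X) (γ : Path x x) (_ : ¬ γ.Homotopic (Path.refl x)), pathLength γ

/-- The `m`-dimensional Alexandrov width `UR_m(X)`: the infimum of the `r ≥ 0` such that `X` has
a cover by connected open sets, each contained in a metric ball of radius `r`, such that every
point lies in at most `m + 1` of them (no `m + 2` of them have a common point). -/
noncomputable def alexandrovWidth (X : Type u) [PseudoMetricSpace X] (m : ℕ) : ℝ≥0∞ :=
  ⨅ (r : ℝ≥0) (_ : ∃ 𝒰 : Set (Set X), ⋃₀ 𝒰 = Set.univ ∧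
      (∀ U ∈ 𝒰, IsOpen U ∧ IsConnected U ∧ ∃ p : X, U ⊆ Metric.closedBall p r) ∧
      ∀ x : X, {U ∈ 𝒰 | x ∈ U}.encard ≤ m + 1), (r : ℝ≥0∞)

/-- `K` is an Eilenberg–MacLane space `K(G, 1)`: it is path-connected, its fundamental group is
isomorphic to `G`, and its higher homotopy groups are trivial. -/
structure IsEilenbergMacLaneOne (K : Type u) [TopologicalSpace K] (G : Type u) [Group G] :
    Prop where
  pathConnected : PathConnectedSpace K
  fundamentalGroup : ∀ y : K, Nonempty (FundamentalGroup K y ≃* G)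
  higher_trivial : ∀ (y : K) (k : ℕ), 2 ≤ k → Subsingleton (HomotopyGroup.Pi k K y)

/-- An `n`-dimensional (path-connected) complex `X` is essential: no continuous map from `X` to
a CW complex `K = K(π₁(X), 1)` that induces an isomorphism of fundamental groups has its image in
the `(n - 1)`-skeleton of `K`, that is, in the union `skeletonLT n` of the cells of dimension less
than `n`. -/
def IsEssential (X : Type u) [TopologicalSpace X] (n : ℕ) : Prop :=
  ∀ (K : Type u) [TopologicalSpace K] [T2Space K] [Topology.CWComplex (Set.univ : Set K)],
    (∀ x : X, IsEilenbergMacLaneOne K (FundamentalGroup X x)) →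
    ∀ f : C(X, K), (∀ x : X, Function.Bijective (FundamentalGroup.map f x)) →
      ¬ Set.range f ⊆ (Topology.RelCWComplex.skeletonLT (Set.univ : Set K) (n : ℕ∞) : Set K)

/-! Suppose `X` had an open cover by subsets of balls of radius `r`, with `2 r` less than the
systole and at most `n` sets through any point. Join the center of such a ball to each of its points
by a nearly shortest path. For two nearby points of the ball, the two chosen paths and a short link
form a loop shorter than the systole, hence contractible. Cutting up an arbitrary path in the ball
shows that the chosen classes are compatible with it (`IsLengthSpace.exists_classes`). The sheets of
the universal cover over each member of the cover are thus labelled by `G = π₁(X)`.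

Labels and bump functions together define a `G`-equivariant map from homotopy classes of paths in
`X` to Milnor's infinite join of copies of `G`, and so a map from `X` to the quotient of the join by
`G`. Compact subsets of the join can be coned off, and the projection to the quotient is a covering,
so the quotient is a `K(G, 1)` (`MilnorBase.subsingleton_homotopyGroup`,
`PathClassCover.isEilenbergMacLaneOne`). Monodromy shows that the map is an isomorphism on
fundamental groups (`PathClassCover.bijective_map`).

The weights in the join are normalized to have maximum `1`, not sum `1`. The cells of the quotient
are then cubes, with one coordinate for each weight strictly between `0` and `1`. Some weight equals
`1`, so at most `n` nonzero weights put a point in the `(n - 1)`-skeleton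
(`MilnorBase.mem_skeletonLT`). This contradicts essentiality. -/

open Topology unitInterval Topology.Homotopy

/-! ### The infinite join and its weak topology -/

/-- The weight functions on `{j | j < n}` with values in `[0, 1]` and maximum `1`. -/
def maxSimplex (n : ℕ) : Set (ℕ → ℝ) :=
  {t | (∀ j, 0 ≤ t j ∧ t j ≤ 1) ∧ (∀ j, n ≤ j → t j = 0) ∧ ∃ j, t j = 1}

/-- The infinite join of copies of a group `G`: finitely supported weight functions with maximum
`1`, together with a label in `G` at every index of the support. -/
@[ext] structure MilnorTotal (G : Type u) [Group G] where
  wt : ℕ → ℝ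
  lab : ℕ → G
  wt_mem : ∃ n, wt ∈ maxSimplex n
  lab_eq_one : ∀ j, wt j = 0 → lab j = 1

namespace MilnorTotal

variable {G : Type u} [Group G]

open Classical in
/-- The cell with labels `g`. -/
noncomputable def chi {n : ℕ} (g : ℕ → G) (t : maxSimplex n) : MilnorTotal G where
  wt := t.1
  lab j := if t.1 j = 0 then 1 else g j
  wt_mem := ⟨n, t.2⟩
  lab_eq_one j hj := by simp [hj]

@[simp] theorem chi_wt {n : ℕ} (g : ℕ → G) (t : maxSimplex n) : (chi g t).wt = t.1 := rfl

theorem chi_lab_of_ne {n : ℕ} (g : ℕ → G) (t : maxSimplex n) {j : ℕ} (h : t.1 j ≠ 0) :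
    (chi g t).lab j = g j := by simp [chi, h]

theorem ext' {e e' : MilnorTotal G} (hw : ∀ j, e.wt j = e'.wt j)
    (hl : ∀ j, e.wt j ≠ 0 → e.lab j = e'.lab j) : e = e' := by
  ext j
  · exact hw j
  · by_cases h : e.wt j = 0
    · rw [e.lab_eq_one j h, e'.lab_eq_one j (hw j ▸ h)]
    · exact hl j h

theorem chi_eq_chi {n m : ℕ} {g h : ℕ → G} {t : maxSimplex n} {s : maxSimplex m}
    (hw : t.1 = s.1) (hl : ∀ j, t.1 j ≠ 0 → g j = h j) : chi g t = chi h s :=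
  ext' (fun j => congrFun hw j) fun j hj => by
    rw [chi_lab_of_ne g t hj, chi_lab_of_ne h s (by rw [← hw]; exact hj), hl j hj]

theorem chi_self (e : MilnorTotal G) {n : ℕ} (h : e.wt ∈ maxSimplex n) :
    chi e.lab ⟨e.wt, h⟩ = e :=
  ext' (fun _ => rfl) fun _ hj => chi_lab_of_ne _ _ hj

theorem wt_nonneg (e : MilnorTotal G) (j : ℕ) : 0 ≤ e.wt j := (e.wt_mem.choose_spec.1 j).1

theorem wt_le_one (e : MilnorTotal G) (j : ℕ) : e.wt j ≤ 1 := (e.wt_mem.choose_spec.1 j).2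

theorem exists_wt_eq_one (e : MilnorTotal G) : ∃ j, e.wt j = 1 := e.wt_mem.choose_spec.2.2

/-- The final topology for all cells: continuity out of the join is tested cell by cell, and the
quotient can carry a CW structure. -/
noncomputable instance : TopologicalSpace (MilnorTotal G) :=
  ⨆ (n : ℕ) (g : ℕ → G), TopologicalSpace.coinduced (chi g : maxSimplex n → MilnorTotal G)
    inferInstance

theorem continuous_chi {n : ℕ} (g : ℕ → G) : Continuous (chi g : maxSimplex n → MilnorTotal G) :=
  continuous_iff_coinduced_le.2 <|
    le_iSup₂_of_le (f := fun (n : ℕ) (g : ℕ → G) => TopologicalSpace.coinduced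
      (chi g : maxSimplex n → MilnorTotal G) inferInstance) n g le_rfl

theorem continuous_iff {Y : Type*} [TopologicalSpace Y] {f : MilnorTotal G → Y} :
    Continuous f ↔ ∀ (n : ℕ) (g : ℕ → G), Continuous fun t : maxSimplex n => f (chi g t) := by
  refine ⟨fun h n g => h.comp (continuous_chi g), fun h => ?_⟩
  refine continuous_iSup_dom.2 fun n => continuous_iSup_dom.2 fun g => ?_
  exact continuous_coinduced_dom.2 (h n g)

theorem isOpen_iff {s : Set (MilnorTotal G)} :
    IsOpen s ↔ ∀ (n : ℕ) (g : ℕ → G), IsOpen {t : maxSimplex n | chi g t ∈ s} := by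
  refine ⟨fun h n g => h.preimage (continuous_chi g), fun h => ?_⟩
  refine isOpen_iSup_iff.2 fun n => isOpen_iSup_iff.2 fun g => ?_
  exact isOpen_coinduced.2 (h n g)

theorem isClosed_iff {s : Set (MilnorTotal G)} :
    IsClosed s ↔ ∀ (n : ℕ) (g : ℕ → G), IsClosed {t : maxSimplex n | chi g t ∈ s} := by
  refine ⟨fun h n g => h.preimage (continuous_chi g), fun h => ?_⟩
  refine isClosed_iSup_iff.2 fun n => isClosed_iSup_iff.2 fun g => ?_
  exact isClosed_coinduced.2 (h n g)

/-- A map with continuous weights, uniformly bounded support and constant labels is continuous. -/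
theorem continuous_of_wt {Y : Type*} [TopologicalSpace Y] {f : Y → MilnorTotal G} (n : ℕ)
    (g : ℕ → G) (hn : ∀ y j, n ≤ j → (f y).wt j = 0) (hw : ∀ j, Continuous fun y => (f y).wt j)
    (hl : ∀ y j, (f y).wt j ≠ 0 → (f y).lab j = g j) : Continuous f := by
  have hm : ∀ y, (f y).wt ∈ maxSimplex n := fun y =>
    ⟨fun j => ⟨wt_nonneg _ j, wt_le_one _ j⟩, hn y, exists_wt_eq_one _⟩
  have : f = fun y => chi g (⟨(f y).wt, hm y⟩ : maxSimplex n) := by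
    funext y
    exact ext' (fun j => rfl) fun j hj => by rw [chi_lab_of_ne g _ hj, hl y j hj]
  rw [this]
  exact (continuous_chi g).comp ((continuous_pi hw).subtype_mk _)

theorem continuous_wt (j : ℕ) : Continuous fun e : MilnorTotal G => e.wt j :=
  continuous_iff.2 fun _ _ => (continuous_apply j).comp continuous_subtype_val

/-- Labels are locally constant where their weight is nonzero. The covering property and the
Hausdorff property both rest on this. -/
theorem isOpen_lab (j : ℕ) (S : Set G) : IsOpen {e : MilnorTotal G | e.wt j ≠ 0 ∧ e.lab j ∈ S} := by
  refine isOpen_iff.2 fun n g => ?_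
  have : {t : maxSimplex n | chi g t ∈ {e : MilnorTotal G | e.wt j ≠ 0 ∧ e.lab j ∈ S}} =
      {t : maxSimplex n | t.1 j ≠ 0 ∧ g j ∈ S} := by
    ext t
    simp only [Set.mem_ofPred_eq, chi_wt]
    exact and_congr_right fun h => by rw [chi_lab_of_ne g t h]
  rw [this]
  exact (isOpen_ne_fun ((continuous_apply j).comp continuous_subtype_val) continuous_const).and
    isOpen_const

open Classical in
noncomputable instance : MulAction G (MilnorTotal G) where
  smul g e :=
    { wt := e.wt
      lab := fun j => if e.wt j = 0 then 1 else g * e.lab j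
      wt_mem := e.wt_mem
      lab_eq_one := fun j hj => by simp [hj] }
  one_smul e := ext' (fun _ => rfl) fun j (hj : e.wt j ≠ 0) =>
    show (if e.wt j = 0 then 1 else 1 * e.lab j) = e.lab j by simp [hj]
  mul_smul g h e := ext' (fun _ => rfl) fun j (hj : e.wt j ≠ 0) =>
    show (if e.wt j = 0 then 1 else g * h * e.lab j) =
      if e.wt j = 0 then 1 else g * (if e.wt j = 0 then 1 else h * e.lab j) by simp [hj, mul_assoc]

@[simp] theorem smul_wt (g : G) (e : MilnorTotal G) : (g • e).wt = e.wt := rfl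

theorem smul_lab (g : G) (e : MilnorTotal G) {j : ℕ} (hj : e.wt j ≠ 0) :
    (g • e).lab j = g * e.lab j := if_neg hj

theorem smul_chi {n : ℕ} (g : G) (h : ℕ → G) (t : maxSimplex n) :
    g • chi h t = chi (fun j => g * h j) t :=
  ext' (fun _ => rfl) fun j hj => by
    rw [smul_lab g (chi h t) hj, chi_lab_of_ne h t hj, chi_lab_of_ne _ t hj]

instance : ContinuousConstSMul G (MilnorTotal G) where
  continuous_const_smul g := continuous_iff.2 fun n h => by
    simp only [smul_chi]
    exact continuous_chi _

end MilnorTotal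

/-! ### The classifying space as a Hausdorff covering quotient -/

/-- The quotient of the infinite join of copies of `G` by the action of `G`, a classifying
space for `G`. -/
noncomputable def MilnorBase (G : Type u) [Group G] : Type u := MulAction.orbitRel.Quotient G (MilnorTotal G)

namespace MilnorBase

variable {G : Type u} [Group G]

noncomputable instance : TopologicalSpace (MilnorBase G) :=
  inferInstanceAs (TopologicalSpace (Quotient (MulAction.orbitRel G (MilnorTotal G))))

/-- The projection of the universal cover. -/
noncomputable def proj (e : MilnorTotal G) : MilnorBase G := Quotient.mk (MulAction.orbitRel G (MilnorTotal G)) e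

theorem proj_eq_iff {e e' : MilnorTotal G} : proj e = proj e' ↔ ∃ g : G, g • e' = e :=
  Quotient.eq''

/-- Near a point with `j`-th weight `1` the `j`-th label is constant, and a nontrivial `g` changes
it; so `g` moves this neighborhood off itself. -/
theorem isQuotientCoveringMap_proj :
    IsQuotientCoveringMap (proj : MilnorTotal G → MilnorBase G) G where
  toIsQuotientMap := isQuotientMap_quotient_mk'
  toContinuousConstSMul := inferInstance
  apply_eq_iff_mem_orbit := proj_eq_iff
  disjoint e := by
    obtain ⟨j, hj⟩ := e.exists_wt_eq_one
    refine ⟨_, (MilnorTotal.isOpen_lab j {e.lab j}).mem_nhds ⟨by simp [hj], rfl⟩, ?_⟩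
    rintro g ⟨_, ⟨a, ⟨ha, hal⟩, rfl⟩, hb, hbl⟩
    simp only [Set.mem_singleton_iff] at hal hbl
    rw [MilnorTotal.smul_lab g a ha, hal] at hbl
    simpa using hbl

theorem isOpenQuotientMap_proj : IsOpenQuotientMap (proj : MilnorTotal G → MilnorBase G) :=
  isQuotientCoveringMap_proj.isOpenQuotientMap

theorem continuous_proj : Continuous (proj : MilnorTotal G → MilnorBase G) :=
  isOpenQuotientMap_proj.continuous

/-- The weights of a point of the classifying space. -/
noncomputable def wt (x : MilnorBase G) : ℕ → ℝ :=
  Quotient.lift MilnorTotal.wt (by rintro _ b ⟨g, rfl⟩; rfl) x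

@[simp] theorem wt_proj (e : MilnorTotal G) : wt (proj e) = e.wt := rfl

theorem continuous_wt (j : ℕ) : Continuous fun x : MilnorBase G => x.wt j :=
  isOpenQuotientMap_proj.isQuotientMap.continuous_iff.2 (MilnorTotal.continuous_wt j)

/-- Points with different weights are separated by a weight. Otherwise choose lifts whose labels
agree at an index `i` of weight `1`; they then differ at some other index `j` of the support. Fixing
the label at `i` rigidifies the action, so the label at `j` separates the orbits. -/
instance : T2Space (MilnorBase G) where
  t2 x y hxy := by
    by_cases hw : ∀ j, x.wt j = y.wt j
    swap
    · push Not at hw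
      obtain ⟨j, hj⟩ := hw
      exact separated_by_continuous (continuous_wt j) hj
    obtain ⟨e, rfl⟩ := isOpenQuotientMap_proj.surjective x
    obtain ⟨e', rfl⟩ := isOpenQuotientMap_proj.surjective y
    simp only [wt_proj] at hw
    obtain ⟨i, hi⟩ := e.exists_wt_eq_one
    have hi0 : e.wt i ≠ 0 := by simp [hi]
    obtain ⟨e'', he'', hl, hw⟩ : ∃ e'', proj e'' = proj e' ∧ e''.lab i = e.lab i ∧
        ∀ j, e.wt j = e''.wt j := by
      refine ⟨(e.lab i * (e'.lab i)⁻¹) • e', proj_eq_iff.2 ⟨_, rfl⟩, ?_, hw⟩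
      rw [MilnorTotal.smul_lab _ _ (by rwa [← hw])]
      simp
    rw [← he''] at hxy ⊢
    obtain ⟨j, hj, hlj⟩ : ∃ j, e.wt j ≠ 0 ∧ e.lab j ≠ e''.lab j := by
      by_contra! h
      exact hxy (congrArg proj (MilnorTotal.ext' hw h))
    refine ⟨proj '' ({a | a.wt i ≠ 0 ∧ a.lab i ∈ ({e.lab i} : Set G)} ∩
        {a | a.wt j ≠ 0 ∧ a.lab j ∈ ({e.lab j} : Set G)}),
      proj '' ({a | a.wt i ≠ 0 ∧ a.lab i ∈ ({e.lab i} : Set G)} ∩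
        {a | a.wt j ≠ 0 ∧ a.lab j ∈ ({e.lab j}ᶜ : Set G)}),
      isOpenQuotientMap_proj.isOpenMap _
        ((MilnorTotal.isOpen_lab _ _).inter (MilnorTotal.isOpen_lab _ _)),
      isOpenQuotientMap_proj.isOpenMap _
        ((MilnorTotal.isOpen_lab _ _).inter (MilnorTotal.isOpen_lab _ _)),
      ⟨e, ⟨⟨hi0, rfl⟩, hj, rfl⟩, rfl⟩,
      ⟨e'', ⟨⟨by rwa [← hw], hl⟩, by rwa [← hw], fun h => hlj h.symm⟩, rfl⟩, ?_⟩
    rw [Set.disjoint_left]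
    rintro _ ⟨a, ⟨⟨ha, hai⟩, ha', haj⟩, rfl⟩ ⟨b, ⟨⟨hb, hbi⟩, hb', hbj⟩, hab⟩
    obtain ⟨g, rfl⟩ := proj_eq_iff.1 hab
    simp only [Set.mem_singleton_iff, Set.mem_compl_iff] at hai haj hbi hbj
    rw [MilnorTotal.smul_lab _ _ ha, hai] at hbi
    rw [MilnorTotal.smul_lab _ _ ha', haj] at hbj
    have : g = 1 := by simpa using hbi
    simp [this] at hbj

end MilnorBase

/-! ### Cones over finite stages of the join -/

namespace MilnorTotal

variable {G : Type u} [Group G]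

/-- The points whose support lies in `{j | j < n}`. -/
def supportedBelow (G : Type u) [Group G] (n : ℕ) : Set (MilnorTotal G) :=
  {e | ∀ j, n ≤ j → e.wt j = 0}

theorem wt_mem_maxSimplex {n : ℕ} {e : MilnorTotal G} (h : e ∈ supportedBelow G n) :
    e.wt ∈ maxSimplex n :=
  ⟨fun j => ⟨e.wt_nonneg j, e.wt_le_one j⟩, h, e.exists_wt_eq_one⟩

theorem continuous_finsum_wt (a : ℕ → ℝ) :
    Continuous fun e : MilnorTotal G => ∑ᶠ j, a j * e.wt j := by
  refine continuous_iff.2 fun n g => ?_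
  have : (fun t : maxSimplex n => ∑ᶠ j, a j * (chi g t).wt j) =
      fun t => ∑ j ∈ Finset.range n, a j * t.1 j := by
    funext t
    refine finsum_eq_sum_of_support_subset _ fun j hj => ?_
    by_contra h
    exact hj (by simp [t.2.2.1 j (by simpa using h)])
  rw [this]
  exact continuous_finsetSum _ fun j _ =>
    continuous_const.mul ((continuous_apply j).comp continuous_subtype_val)

/-- A compact set involves only finitely many indices. -/
theorem exists_subset_supportedBelow {C : Set (MilnorTotal G)} (hC : IsCompact C) :
    ∃ n, C ⊆ supportedBelow G n := by
  by_contra! h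
  have h' : ∀ n, ∃ e ∈ C, ∃ j, n ≤ j ∧ e.wt j ≠ 0 := fun n => by
    obtain ⟨e, he, hn⟩ := Set.not_subset.1 (h n)
    simp only [supportedBelow, Set.mem_ofPred_eq, not_forall] at hn
    obtain ⟨j, hj, hj'⟩ := hn
    exact ⟨e, he, j, hj, hj'⟩
  choose e heC j hj hne using h'
  -- Since `n ≤ j n`, the sum defining `a (j n)` contains `n / (e n).wt (j n)`, so the weighted sum
  -- is at least `n` at `e n`: unbounded on a compact set. Terms with vanishing weight are `0`.
  let a : ℕ → ℝ := fun i => ∑ m ∈ Finset.range (i + 1), (m : ℝ) / (e m).wt i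
  have ha : ∀ i, 0 ≤ a i := fun i =>
    Finset.sum_nonneg fun m _ => div_nonneg m.cast_nonneg (wt_nonneg _ _)
  obtain ⟨B, hB⟩ := (hC.image (continuous_finsum_wt (G := G) a)).bddAbove
  obtain ⟨n, hn⟩ := exists_nat_gt B
  have h1 : ∑ᶠ i, a i * (e n).wt i ≤ B := hB ⟨e n, heC n, rfl⟩
  have hpos : 0 < (e n).wt (j n) := lt_of_le_of_ne (wt_nonneg _ _) (hne n).symm
  have h2 : a (j n) * (e n).wt (j n) ≤ ∑ᶠ i, a i * (e n).wt i := by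
    refine single_le_finsum (f := fun i => a i * (e n).wt i) (j n) ?_
      fun i => mul_nonneg (ha i) (wt_nonneg _ _)
    obtain ⟨N, hN⟩ := (e n).wt_mem
    refine (Set.finite_lt_nat N).subset fun i hi => ?_
    by_contra h
    exact hi (by simp [hN.2.1 i (by simpa using h)])
  have h3 : (n : ℝ) / (e n).wt (j n) ≤ a (j n) :=
    Finset.single_le_sum (f := fun m : ℕ => (m : ℝ) / (e m).wt (j n))
      (fun m _ => div_nonneg m.cast_nonneg (wt_nonneg _ _))
      (Finset.mem_range.2 (Nat.lt_succ_of_le (hj n)))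
  have h4 := (div_le_iff₀ hpos).1 h3
  linarith

/-- The disjoint union of the cells with indices below `n`. -/
noncomputable def chiBelow (n : ℕ) (p : Σ _ : ℕ → G, maxSimplex n) : supportedBelow G n :=
  ⟨chi p.1 p.2, p.2.2.2.1⟩

/-- The subspace topology on a finite stage is again the weak one: each larger cell meets the stage
in a closed face, which is itself part of a cell below `n`. -/
theorem isQuotientMap_chiBelow (n : ℕ) : IsQuotientMap (chiBelow n (G := G)) := by
  refine isQuotientMap_iff_isClosed.2 ⟨fun e => ?_, fun A => ⟨fun h => ?_, fun h => ?_⟩⟩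
  · exact ⟨⟨e.1.lab, e.1.wt, wt_mem_maxSimplex e.2⟩, Subtype.ext (chi_self _ _)⟩
  · exact h.preimage (continuous_sigma fun g => (continuous_chi g).subtype_mk _)
  · suffices IsClosed (Subtype.val '' A) by
      have h2 := this.preimage (continuous_subtype_val (p := (· ∈ supportedBelow G n)))
      rwa [Set.preimage_image_eq _ Subtype.val_injective] at h2
    refine isClosed_iff.2 fun m g => ?_
    have hc : IsClosed {t : maxSimplex m | ∀ j, n ≤ j → t.1 j = 0} := by
      simp only [Set.ofPred_forall]
      exact isClosed_iInter fun j => isClosed_iInter fun _ =>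
        isClosed_eq ((continuous_apply j).comp continuous_subtype_val) continuous_const
    let r : {t : maxSimplex m | ∀ j, n ≤ j → t.1 j = 0} → maxSimplex n :=
      fun t => ⟨t.1.1, t.1.2.1, t.2, t.1.2.2.2⟩
    have hr : Continuous r := (continuous_subtype_val.comp continuous_subtype_val).subtype_mk _
    have hA : IsClosed (r ⁻¹' {t | chiBelow n ⟨g, t⟩ ∈ A}) :=
      (isClosed_sigma_iff.1 h g).preimage hr
    convert hc.isClosedEmbedding_subtypeVal.isClosedMap _ hA using 1
    ext t
    constructor
    · rintro ⟨a, ha, hat⟩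
      have ht : ∀ j, n ≤ j → t.1 j = 0 := fun j hj => by
        have := a.2 j hj
        rwa [hat] at this
      refine ⟨⟨t, ht⟩, ?_, rfl⟩
      have : chiBelow n ⟨g, r ⟨t, ht⟩⟩ = a := Subtype.ext (by rw [hat]; rfl)
      change chiBelow n ⟨g, r ⟨t, ht⟩⟩ ∈ A
      rw [this]
      exact ha
    · rintro ⟨⟨t, ht⟩, htA, rfl⟩
      exact ⟨_, htA, rfl⟩

/-- The weights of the cone with apex the vertex of index `n`. -/
noncomputable def coneWt (n : ℕ) (t : ℕ → ℝ) (s : ℝ) : ℕ → ℝ := fun j =>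
  if j < n then min 1 (2 - 2 * s) * t j else if j = n then min 1 (2 * s) else 0

/-- The maximum stays `1` because the apex weight rises to `1` before the old weights start to
shrink, at `s = 1 / 2`. -/
theorem coneWt_mem {n : ℕ} {t : ℕ → ℝ} (ht : t ∈ maxSimplex n) (s : I) :
    coneWt n t s ∈ maxSimplex (n + 1) := by
  have hs0 := s.2.1
  have hs1 := s.2.2
  refine ⟨fun j => ?_, fun j hj => ?_, ?_⟩
  · have := ht.1 j
    have h1 : 0 ≤ min 1 (2 - 2 * (s : ℝ)) := le_min zero_le_one (by linarith)
    have h2 : min 1 (2 - 2 * (s : ℝ)) ≤ 1 := min_le_left _ _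
    unfold coneWt
    split_ifs
    · exact ⟨mul_nonneg h1 this.1, mul_le_one₀ h2 this.1 this.2⟩
    · exact ⟨le_min zero_le_one (by linarith), min_le_left _ _⟩
    · simp
  · unfold coneWt
    rw [if_neg (by omega), if_neg (by omega)]
  · rcases le_total (s : ℝ) (1 / 2) with h | h
    · obtain ⟨j, hj⟩ := ht.2.2
      refine ⟨j, ?_⟩
      have hjn : j < n := by
        by_contra hjn
        rw [ht.2.1 j (by omega)] at hj
        norm_num at hj
      rw [coneWt, if_pos hjn, hj, min_eq_left (by linarith), one_mul]
    · exact ⟨n, by rw [coneWt, if_neg (lt_irrefl n), if_pos rfl, min_eq_left (by linarith)]⟩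

/-- The cone on the points with support below `n`. -/
noncomputable def cone (n : ℕ) (p : supportedBelow G n × I) : MilnorTotal G :=
  chi (Function.update p.1.1.lab n 1)
    (⟨coneWt n p.1.1.wt p.2, coneWt_mem (wt_mem_maxSimplex p.1.2) p.2⟩ : maxSimplex (n + 1))

/-- The labels are constant only on single cells, so continuity is checked there. This suffices
because the product of `chiBelow` with the interval is still a quotient map. -/
theorem continuous_cone (n : ℕ) : Continuous (cone n (G := G)) := by
  refine (isQuotientMap_chiBelow n).continuous_lift_prod_left ?_
  suffices ∀ g : ℕ → G, Continuous fun p : maxSimplex n × I => cone n (chiBelow n ⟨g, p.1⟩, p.2) by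
    have h : Continuous fun q : Σ _ : ℕ → G, maxSimplex n × I =>
        cone n (chiBelow n ⟨q.1, q.2.1⟩, q.2.2) := continuous_sigma this
    exact h.comp (Homeomorph.sigmaProdDistrib (X := fun _ : ℕ → G => maxSimplex n) (Y := I)).continuous
  intro g
  refine continuous_of_wt (n + 1) (Function.update g n 1)
    (fun y j hj => (coneWt_mem y.1.2 y.2).2.1 j hj) (fun j => ?_) fun y j hj => ?_
  · have : Continuous fun y : maxSimplex n × I => y.1.1 j :=
      (continuous_apply j).comp (continuous_subtype_val.comp continuous_fst)
    change Continuous fun y : maxSimplex n × I => coneWt n y.1.1 y.2 j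
    unfold coneWt
    split_ifs <;> fun_prop
  · rw [cone, chi_lab_of_ne _ _ hj]
    rcases eq_or_ne j n with rfl | hjn
    · simp
    · rw [Function.update_of_ne hjn, Function.update_of_ne hjn]
      refine chi_lab_of_ne g y.1 fun h0 => hj ?_
      change coneWt n y.1.1 y.2 j = 0
      unfold coneWt
      split_ifs <;> simp [h0]

theorem cone_zero (n : ℕ) (e : supportedBelow G n) : cone n (e, 0) = e.1 := by
  have hw : ∀ j, (cone n (e, 0)).wt j = e.1.wt j := fun j => by
    change coneWt n e.1.wt (0 : I) j = _
    unfold coneWt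
    split_ifs with h1 h2
    · simp
    · simp [e.2 j (by omega)]
    · exact (e.2 j (by omega)).symm
  refine ext' hw fun j hj => ?_
  rw [cone, chi_lab_of_ne _ _ hj, Function.update_of_ne]
  rintro rfl
  exact hj ((hw j).trans (e.2 j le_rfl))

theorem cone_one (n : ℕ) (e e' : supportedBelow G n) : cone n (e, 1) = cone n (e', 1) := by
  have h : ∀ e : supportedBelow G n, ∀ j, j ≠ n → (cone n (e, 1)).wt j = 0 := fun e j hj => by
    change coneWt n e.1.wt (1 : I) j = 0
    simp [coneWt, hj]
  have h' : ∀ e : supportedBelow G n, (cone n (e, 1)).wt n = 1 := fun e => by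
    change coneWt n e.1.wt (1 : I) n = 1
    simp [coneWt]
  have hl : ∀ e : supportedBelow G n, (cone n (e, 1)).lab n = 1 := fun e => by
    rw [cone, chi_lab_of_ne _ _ ((h' e).trans_ne one_ne_zero), Function.update_self]
  refine ext' (fun j => ?_) fun j hj => ?_
  · rcases eq_or_ne j n with rfl | hj
    · rw [h', h']
    · rw [h _ _ hj, h _ _ hj]
  · rcases eq_or_ne j n with rfl | hjn
    · rw [hl, hl]
    · exact absurd (h _ _ hjn) hj

instance : Nonempty (MilnorTotal G) :=
  ⟨⟨fun j => if j = 0 then 1 else 0, fun _ => 1, ⟨1, fun j => by dsimp only; split_ifs <;> simp,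
    fun j hj => if_neg (by omega), 0, if_pos rfl⟩, fun _ _ => rfl⟩⟩

theorem supportedBelow_mono {m n : ℕ} (h : m ≤ n) : supportedBelow G m ⊆ supportedBelow G n :=
  fun _ he j hj => he j (h.trans hj)

instance : PathConnectedSpace (MilnorTotal G) where
  nonempty := inferInstance
  joined e e' := by
    obtain ⟨m, hm⟩ := e.wt_mem
    obtain ⟨m', hm'⟩ := e'.wt_mem
    have he : e ∈ supportedBelow G (max m m') := supportedBelow_mono (le_max_left _ _) hm.2.1
    have he' : e' ∈ supportedBelow G (max m m') := supportedBelow_mono (le_max_right _ _) hm'.2.1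
    have key : ∀ a : supportedBelow G (max m m'), Joined a.1 (cone _ (a, 1)) := fun a =>
      ⟨⟨⟨fun s => cone _ (a, s), (continuous_cone _).comp (by fun_prop)⟩, cone_zero _ a, rfl⟩⟩
    have h1 := key ⟨e, he⟩
    have h2 := key ⟨e', he'⟩
    rw [cone_one _ _ ⟨e, he⟩] at h2
    exact h1.trans h2.symm

end MilnorTotal

instance {G : Type u} [Group G] : PathConnectedSpace (MilnorBase G) :=
  MilnorBase.isOpenQuotientMap_proj.surjective.pathConnectedSpace MilnorBase.continuous_proj

/-! ### Vanishing of the higher homotopy groups -/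

theorem ContinuousMap.HomotopicRel.of_continuous {A Y : Type*} [TopologicalSpace A]
    [TopologicalSpace Y] {f g : C(A, Y)} {S : Set A} (H : I × A → Y) (hc : Continuous H)
    (h0 : ∀ a, H (0, a) = f a) (h1 : ∀ a, H (1, a) = g a)
    (hS : ∀ s, ∀ a ∈ S, H (s, a) = f a) : f.HomotopicRel g S :=
  ⟨{ toFun := H
     continuous_toFun := hc
     map_zero_left := h0
     map_one_left := h1
     prop' := hS }⟩

/-- The piecewise linear map `x ↦ (1 + s) x - s / 2`, clamped to the unit interval. -/
noncomputable def stretch (s x : I) : I :=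
  Set.projIcc (0 : ℝ) 1 zero_le_one ((1 + s) * x - s / 2)

/-- Four times the distance to the boundary of the unit interval, clamped. -/
noncomputable def collar (x : I) : I :=
  Set.projIcc (0 : ℝ) 1 zero_le_one (4 * min (x : ℝ) (1 - x))

theorem continuous_stretch : Continuous fun p : I × I => stretch p.1 p.2 :=
  continuous_projIcc.comp (by fun_prop)

theorem continuous_collar : Continuous collar := continuous_projIcc.comp (by fun_prop)

theorem stretch_zero_left (x : I) : stretch 0 x = x := by
  simp [stretch, Set.projIcc_val]

theorem stretch_zero_right (s : I) : stretch s 0 = 0 :=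
  projIcc_eq_zero.2 (by have := s.2.1; simp; linarith)

theorem stretch_one_right (s : I) : stretch s 1 = 1 :=
  projIcc_eq_one.2 (by have := s.2.1; simp; linarith)

theorem collar_zero : collar 0 = 0 := projIcc_eq_zero.2 (by simp)

theorem collar_one : collar 1 = 0 := projIcc_eq_zero.2 (by simp)

/-- At time `1` the stretch is `2 x - 1 / 2`, which collapses the outer quarters to the end points;
on the middle half the collar function is already `1`. -/
theorem collar_eq_one_or (x : I) : collar x = 1 ∨ stretch 1 x = 0 ∨ stretch 1 x = 1 := by
  rcases le_total (x : ℝ) (1 / 4) with h | h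
  · exact Or.inr (Or.inl (projIcc_eq_zero.2 (by simp; linarith)))
  rcases le_total (3 / 4) (x : ℝ) with h' | h'
  · exact Or.inr (Or.inr (projIcc_eq_one.2 (by simp; linarith)))
  · exact Or.inl (projIcc_eq_one.2 (by
      have : 1 / 4 ≤ min (x : ℝ) (1 - x) := le_min h (by linarith)
      linarith))

/-- A generalized loop that admits a free nullhomotopy, constant on the boundary at every time,
is homotopic to the constant loop relative to the boundary. -/
theorem GenLoop.homotopic_const_of_nullhomotopy {N Y : Type*} [Fintype N] [Nonempty N]
    [TopologicalSpace Y] {y : Y} (γ : Ω^ N Y y) (F : (N → I) × I → Y) (hF : Continuous F)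
    (h0 : ∀ u, F (u, 0) = γ u) (h1 : ∀ u u', F (u, 1) = F (u', 1))
    (hb : ∀ s, ∀ u ∈ Cube.boundary N, ∀ u' ∈ Cube.boundary N, F (u, s) = F (u', s)) :
    GenLoop.Homotopic γ GenLoop.const := by
  obtain ⟨b, hbd⟩ : ∃ b : N → I, b ∈ Cube.boundary N :=
    ⟨fun _ => 0, Classical.arbitrary N, Or.inl rfl⟩
  -- The free nullhomotopy `F` may move the base point. The stretch `c` clears a collar of the cube,
  -- and `d` is the height to which `F` is run, falling to `0` on the boundary.
  let c : I → (N → I) → (N → I) := fun s u i => stretch s (u i)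
  have hc : Continuous fun p : I × (N → I) => c p.1 p.2 := by
    refine continuous_pi fun i => ?_
    exact continuous_stretch.comp (f := fun p : I × (N → I) => (p.1, p.2 i)) (by fun_prop)
  have hcb : ∀ s, ∀ u ∈ Cube.boundary N, c s u ∈ Cube.boundary N := by
    rintro s u ⟨i, hi | hi⟩
    · exact ⟨i, Or.inl (by simp only [c, hi, stretch_zero_right])⟩
    · exact ⟨i, Or.inr (by simp only [c, hi, stretch_one_right])⟩
  let d : (N → I) → I := fun u => ∏ i, collar (u i)
  have hd : Continuous d :=
    continuous_finsetProd _ fun i _ => continuous_collar.comp (continuous_apply i)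
  have hdb : ∀ u ∈ Cube.boundary N, d u = 0 := by
    rintro u ⟨i, hi⟩
    refine Finset.prod_eq_zero (Finset.mem_univ i) ?_
    rcases hi with hi | hi <;> simp only [hi, collar_zero, collar_one]
  have hcd : ∀ u, d u = 1 ∨ c 1 u ∈ Cube.boundary N := by
    intro u
    by_cases h : ∃ i, stretch 1 (u i) = 0 ∨ stretch 1 (u i) = 1
    · exact Or.inr h
    · push Not at h
      refine Or.inl (Finset.prod_eq_one fun i _ => ?_)
      exact (collar_eq_one_or (u i)).resolve_right (by simpa using h i)
  have hγ : Continuous γ := γ.1.continuous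
  have hc1 : Continuous (c 1) := hc.comp (by fun_prop : Continuous fun u => ((1 : I), u))
  let f1 : C(N → I, Y) := ⟨fun u => γ (c 1 u), hγ.comp hc1⟩
  let f2 : C(N → I, Y) := ⟨fun u => F (c 1 u, d u), hF.comp (hc1.prodMk hd)⟩
  have s1 : γ.1.HomotopicRel f1 (Cube.boundary N) := by
    refine .of_continuous (fun p => γ (c p.1 p.2)) (hγ.comp hc) (fun u => ?_) (fun u => rfl) ?_
    · exact congrArg γ (funext fun i => stretch_zero_left _)
    · intro s u hu
      exact (γ.2 _ (hcb s u hu)).trans (γ.2 u hu).symm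
  have s2 : f1.HomotopicRel f2 (Cube.boundary N) := by
    refine .of_continuous (fun p => F (c 1 p.2, p.1 * d p.2)) ?_ (fun u => ?_) (fun u => ?_) ?_
    · exact hF.comp ((hc1.comp continuous_snd).prodMk
        (continuous_fst.mul (hd.comp continuous_snd)))
    · simp [f1, h0]
    · simp [f2]
    · intro s u hu
      simp [f1, h0, hdb u hu]
  -- Each `f2 u` equals `F (b, d u)`: either `d u = 1`, where `F` does not depend on the point, or
  -- the stretched point lies on the boundary, where `F` agrees with its value at `b`. Scaling `d`
  -- then contracts it.
  have s3 : (GenLoop.const : Ω^ N Y y).1.HomotopicRel f2 (Cube.boundary N) := by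
    refine .of_continuous (fun p => F (b, p.1 * d p.2)) ?_ (fun u => ?_) (fun u => ?_) ?_
    · exact hF.comp (continuous_const.prodMk (continuous_fst.mul (hd.comp continuous_snd)))
    · simpa [h0] using γ.2 b hbd
    · rcases hcd u with h | h
      · change F (b, 1 * d u) = F (c 1 u, d u)
        rw [h, one_mul]
        exact h1 _ _
      · change F (b, 1 * d u) = F (c 1 u, d u)
        rw [one_mul]
        exact hb _ _ hbd _ h
    · intro s u hu
      simpa [h0, hdb u hu] using γ.2 b hbd
  exact (s1.trans s2).trans s3.symm

/-- The image is compact, hence supported below some `n`, and the cone with apex `n` contracts it.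
-/
theorem MilnorTotal.genLoop_homotopic_const {G : Type u} [Group G] {N : Type*} [Fintype N]
    [Nonempty N] {y : MilnorTotal G} (γ : Ω^ N (MilnorTotal G) y) :
    GenLoop.Homotopic γ GenLoop.const := by
  obtain ⟨n, hn⟩ := exists_subset_supportedBelow (isCompact_range γ.1.continuous)
  have hγ : ∀ u, γ u ∈ supportedBelow G n := fun u => hn ⟨u, rfl⟩
  refine GenLoop.homotopic_const_of_nullhomotopy γ (fun p => cone n (⟨γ p.1, hγ p.1⟩, p.2)) ?_
    (fun u => cone_zero n _) (fun u u' => cone_one n _ _) fun s u hu u' hu' => ?_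
  · refine (continuous_cone n).comp ((Continuous.subtype_mk ?_ _).prodMk continuous_snd)
    exact γ.1.continuous.comp continuous_fst
  · have : γ u = γ u' := (γ.2 u hu).trans (γ.2 u' hu').symm
    simp only [this]

instance {G : Type u} [Group G] : SimplyConnectedSpace (MilnorTotal G) := by
  refine simply_connected_iff_loops_nullhomotopic.2 ⟨inferInstance, fun x γ => ?_⟩
  have : Subsingleton (HomotopyGroup.Pi 1 (MilnorTotal G) x) := ⟨fun a b => by
    induction a using Quotient.inductionOn with | _ a =>
    induction b using Quotient.inductionOn with | _ b =>
    exact Quotient.sound ((MilnorTotal.genLoop_homotopic_const a).trans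
      (MilnorTotal.genLoop_homotopic_const b).symm)⟩
  have h2 : Subsingleton (FundamentalGroup (MilnorTotal G) x) :=
    HomotopyGroup.pi1EquivFundamentalGroup.symm.subsingleton
  exact Path.Homotopic.Quotient.exact
    (h2.elim (FundamentalGroup.fromPath (.mk γ)) (FundamentalGroup.fromPath (.mk (Path.refl x))))

/-- Two points of the boundary of a cube of dimension at least `2` are joined by a path in the
boundary. -/
theorem Cube.joinedIn_boundary {k : ℕ} (hk : 2 ≤ k) {u : Fin k → I}
    (hu : u ∈ Cube.boundary (Fin k)) : JoinedIn (Cube.boundary (Fin k)) u 0 := by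
  have key : ∀ u : Fin k → I, ∀ i, u i = 0 → JoinedIn (Cube.boundary (Fin k)) u 0 := by
    intro u i hi
    refine ⟨⟨⟨fun s j => σ s * u j, by fun_prop⟩, by simp, by ext; simp⟩, fun s => ⟨i, Or.inl ?_⟩⟩
    simp [hi]
  obtain ⟨i, hi | hi⟩ := hu
  · exact key u i hi
  · have : Nontrivial (Fin k) := Fin.nontrivial_iff_two_le.2 hk
    obtain ⟨j, hj⟩ := exists_ne i
    refine JoinedIn.trans (y := Function.update u j 0) ?_ (key _ j (by simp))
    refine ⟨⟨⟨fun s => Function.update u j (σ s * u j), by fun_prop⟩, by simp, by simp⟩,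
      fun s => ⟨i, Or.inr ?_⟩⟩
    simp [hj.symm, hi]

instance Cube.contractibleSpace (N : Type*) : ContractibleSpace (N → I) :=
  (contractible_iff_id_nullhomotopic _).2 ⟨0, ⟨{
    toFun := fun p i => σ p.1 * p.2 i
    continuous_toFun := by fun_prop
    map_zero_left := fun u => by ext; simp
    map_one_left := fun u => by ext; simp }⟩⟩

instance unitInterval.locallyPathConnectedSpace : LocallyPathConnectedSpace I :=
  (isQuotientMap_projIcc (h := zero_le_one)).locallyPathConnectedSpace

/-- The higher homotopy groups of the base of a covering map vanish if all generalized loops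
upstairs are nullhomotopic. -/
theorem IsCoveringMap.subsingleton_homotopyGroup {E B : Type*} [TopologicalSpace E]
    [TopologicalSpace B] {p : E → B} (hp : IsCoveringMap p) (hs : Function.Surjective p)
    {k : ℕ} (hk : 2 ≤ k)
    (hE : ∀ (e : E) (γ : Ω^ (Fin k) E e), GenLoop.Homotopic γ GenLoop.const) (b : B) :
    Subsingleton (HomotopyGroup.Pi k B b) := by
  suffices ∀ γ : Ω^ (Fin k) B b, GenLoop.Homotopic γ GenLoop.const from ⟨fun x y => by
    induction x using Quotient.inductionOn with | _ x =>
    induction y using Quotient.inductionOn with | _ y =>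
    exact Quotient.sound ((this x).trans (this y).symm)⟩
  intro γ
  obtain ⟨e, he⟩ := hs b
  have hz : (0 : Fin k → I) ∈ Cube.boundary (Fin k) := ⟨⟨0, by omega⟩, Or.inl rfl⟩
  obtain ⟨Γ, ⟨hΓ0, hΓ⟩, -⟩ := hp.existsUnique_continuousMap_lifts γ.1 (a₀ := 0) (e₀ := e)
    (by rw [he]; exact (γ.2 0 hz).symm)
  -- For `k ≥ 2` the boundary is path-connected. Along a path in it, `Γ` lifts a constant path and
  -- is therefore constant.
  have hΓb : ∀ u ∈ Cube.boundary (Fin k), Γ u = e := by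
    intro u hu
    obtain ⟨w, hw⟩ := (Cube.joinedIn_boundary hk hu).symm
    have h1 : (Γ.comp w.toContinuousMap) = hp.liftPath (.const I b) e he.symm := by
      refine (hp.eq_liftPath_iff' _).2 ⟨?_, ?_⟩
      · funext s
        exact (congrFun hΓ (w s)).trans (γ.2 _ (hw s))
      · simpa using hΓ0
    rw [hp.liftPath_const] at h1
    simpa using congrArg (fun f : C(I, E) => f 1) h1
  have h2 := hE e ⟨Γ, hΓb⟩
  have h3 := ContinuousMap.HomotopicRel.comp_continuousMap h2 ⟨p, hp.continuous⟩
  have e1 : ContinuousMap.comp ⟨p, hp.continuous⟩ Γ = γ.1 := by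
    ext u
    exact congrFun hΓ u
  have e2 : ContinuousMap.comp ⟨p, hp.continuous⟩ (GenLoop.const : Ω^ (Fin k) E e).1 =
      (GenLoop.const : Ω^ (Fin k) B b).1 := by
    ext u
    exact he
  change ContinuousMap.HomotopicRel (ContinuousMap.comp _ Γ) _ _ at h3
  rw [e1, e2] at h3
  exact h3

theorem MilnorBase.subsingleton_homotopyGroup {G : Type u} [Group G] (y : MilnorBase G) (k : ℕ)
    (hk : 2 ≤ k) : Subsingleton (HomotopyGroup.Pi k (MilnorBase G) y) := by
  have : Nonempty (Fin k) := ⟨⟨0, by omega⟩⟩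
  exact isQuotientCoveringMap_proj.isCoveringMap.subsingleton_homotopyGroup
    isOpenQuotientMap_proj.surjective hk (fun _ γ => MilnorTotal.genLoop_homotopic_const γ) y

/-! ### The cubical CW structure, with cells indexed by barycenters -/

/-- Rounding of the points of `(0, 1)` to `1 / 2`. -/
noncomputable def roundHalf (r : ℝ) : ℝ :=
  open Classical in if r = 0 then 0 else if r = 1 then 1 else 1 / 2

theorem roundHalf_eq_zero {r : ℝ} : roundHalf r = 0 ↔ r = 0 := by
  unfold roundHalf; split_ifs <;> simp_all

theorem roundHalf_eq_one {r : ℝ} : roundHalf r = 1 ↔ r = 1 := by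
  unfold roundHalf; split_ifs <;> norm_num <;> simp_all

theorem roundHalf_eq_half {r : ℝ} : roundHalf r = 1 / 2 ↔ r ≠ 0 ∧ r ≠ 1 := by
  unfold roundHalf; split_ifs <;> norm_num <;> simp_all

theorem roundHalf_cases (r : ℝ) : roundHalf r = 0 ∨ roundHalf r = 1 ∨ roundHalf r = 1 / 2 := by
  unfold roundHalf; split_ifs <;> simp

theorem roundHalf_mem {t : ℕ → ℝ} {n : ℕ} (ht : t ∈ maxSimplex n) :
    (fun j => roundHalf (t j)) ∈ maxSimplex n := by
  refine ⟨fun j => ?_, fun j hj => roundHalf_eq_zero.2 (ht.2.1 j hj),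
    ht.2.2.imp fun j hj => roundHalf_eq_one.2 hj⟩
  rcases roundHalf_cases (t j) with h | h | h <;> simp only [h] <;> norm_num

namespace MilnorTotal

variable {G : Type u} [Group G]

/-- The barycenter of the open cell of a point. -/
noncomputable def round (e : MilnorTotal G) : MilnorTotal G where
  wt j := roundHalf (e.wt j)
  lab := e.lab
  wt_mem := e.wt_mem.imp fun _ h => roundHalf_mem h
  lab_eq_one j hj := e.lab_eq_one j (roundHalf_eq_zero.1 hj)

theorem round_smul (g : G) (e : MilnorTotal G) : round (g • e) = g • round e :=
  ext' (fun _ => rfl) fun j hj => by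
    have hj' : e.wt j ≠ 0 := fun h => hj (roundHalf_eq_zero.2 h)
    change (g • e).lab j = _
    rw [smul_lab g e hj', smul_lab g (round e) hj]
    rfl

/-- `b` lies in the closed cell with barycenter `e`. -/
structure IsFace (b e : MilnorTotal G) : Prop where
  zero : ∀ j, e.wt j = 0 → b.wt j = 0
  one : ∀ j, e.wt j = 1 → b.wt j = 1
  lab : ∀ j, b.wt j ≠ 0 → b.lab j = e.lab j

theorem isFace_round (e : MilnorTotal G) : IsFace e (round e) :=
  ⟨fun _ h => roundHalf_eq_zero.1 h, fun _ h => roundHalf_eq_one.1 h, fun _ _ => rfl⟩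

theorem IsFace.smul {b e : MilnorTotal G} (h : IsFace b e) (g : G) : IsFace (g • b) (g • e) :=
  ⟨h.zero, h.one, fun j hj => by
    have he : e.wt j ≠ 0 := fun h0 => hj (h.zero j h0)
    rw [smul_lab g b hj, smul_lab g e he, h.lab j hj]⟩

end MilnorTotal

namespace MilnorBase

variable {G : Type u} [Group G]

open MilnorTotal (IsFace chi)

/-- The barycenter of the open cell of a point. -/
noncomputable def round (x : MilnorBase G) : MilnorBase G :=
  Quotient.lift (fun e => proj (MilnorTotal.round e))
    (by rintro _ b ⟨g, rfl⟩; exact proj_eq_iff.2 ⟨g, (MilnorTotal.round_smul g b).symm⟩) x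

theorem round_proj (e : MilnorTotal G) : round (proj e) = proj e.round := rfl

theorem round_wt (x : MilnorBase G) (j : ℕ) : (round x).wt j = roundHalf (x.wt j) := by
  obtain ⟨e, rfl⟩ := isOpenQuotientMap_proj.surjective x
  rfl

theorem finite_wt_eq_half (x : MilnorBase G) : {j | x.wt j = 1 / 2}.Finite := by
  obtain ⟨e, rfl⟩ := isOpenQuotientMap_proj.surjective x
  obtain ⟨n, hn⟩ := e.wt_mem
  refine (Set.finite_lt_nat n).subset fun j hj => ?_
  by_contra h
  have h0 := hn.2.1 j (by simpa using h)
  have : e.wt j = 1 / 2 := hj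
  norm_num [h0] at this

/-- The indices of weight `1 / 2`. -/
noncomputable def half (x : MilnorBase G) : Finset ℕ := x.finite_wt_eq_half.toFinset

theorem mem_half {x : MilnorBase G} {j : ℕ} : j ∈ half x ↔ x.wt j = 1 / 2 := by
  simp [half]

/-- The cells of dimension `k`, given by their barycenters. -/
def Cell (G : Type u) [Group G] (k : ℕ) : Type u :=
  {x : MilnorBase G // (∀ j, x.wt j = 0 ∨ x.wt j = 1 ∨ x.wt j = 1 / 2) ∧ (half x).card = k}

/-- The barycenter of the open cell of a point, as a cell. -/
noncomputable def cellOf (x : MilnorBase G) : Cell G (half (round x)).card :=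
  ⟨round x, fun j => by rw [round_wt]; exact roundHalf_cases _, rfl⟩

namespace Cell

variable {k : ℕ} (x : Cell G k)

/-- A lift of the barycenter. -/
noncomputable def lift : MilnorTotal G := (isOpenQuotientMap_proj.surjective x.1).choose

theorem proj_lift : proj x.lift = x.1 := (isOpenQuotientMap_proj.surjective x.1).choose_spec

theorem lift_wt (j : ℕ) : x.lift.wt j = x.1.wt j := by rw [← x.proj_lift]; rfl

theorem wt_cases (j : ℕ) : x.lift.wt j = 0 ∨ x.lift.wt j = 1 ∨ x.lift.wt j = 1 / 2 := by
  rw [lift_wt]; exact x.2.1 j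

theorem mem_half_iff {j : ℕ} : j ∈ half x.1 ↔ x.lift.wt j = 1 / 2 := by rw [mem_half, lift_wt]

/-- The indices of the coordinates of a cell. -/
noncomputable def index (i : Fin k) : ℕ := (half x.1).orderEmbOfFin x.2.2 i

theorem index_mem (i : Fin k) : x.index i ∈ half x.1 := Finset.orderEmbOfFin_mem _ _ _

theorem index_injective : Function.Injective x.index := ((half x.1).orderEmbOfFin x.2.2).injective

theorem exists_index {j : ℕ} (hj : j ∈ half x.1) : ∃ i, x.index i = j := by
  have : j ∈ Set.range ((half x.1).orderEmbOfFin x.2.2) := by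
    rw [Finset.range_orderEmbOfFin]; exact hj
  exact this

open Classical in
/-- The weights of the point of a closed cell with coordinates `u` in `[-1, 1]`. -/
noncomputable def fillWt (u : Fin k → ℝ) (j : ℕ) : ℝ :=
  if h : ∃ i, x.index i = j then max 0 (min 1 ((1 + u h.choose) / 2)) else x.lift.wt j

theorem fillWt_index (u : Fin k → ℝ) (i : Fin k) :
    x.fillWt u (x.index i) = max 0 (min 1 ((1 + u i) / 2)) := by
  have h : ∃ i', x.index i' = x.index i := ⟨i, rfl⟩
  rw [fillWt, dif_pos h, x.index_injective h.choose_spec]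

theorem fillWt_of_notMem (u : Fin k → ℝ) {j : ℕ} (hj : j ∉ half x.1) :
    x.fillWt u j = x.lift.wt j := by
  rw [fillWt, dif_neg]
  rintro ⟨i, rfl⟩
  exact hj (x.index_mem i)

theorem fillWt_mem (u : Fin k → ℝ) {n : ℕ} (hn : x.lift.wt ∈ maxSimplex n) :
    x.fillWt u ∈ maxSimplex n := by
  refine ⟨fun j => ?_, fun j hj => ?_, ?_⟩
  · by_cases h : j ∈ half x.1
    · obtain ⟨i, rfl⟩ := x.exists_index h
      rw [fillWt_index]
      exact ⟨le_max_left _ _, max_le zero_le_one (min_le_left _ _)⟩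
    · rw [fillWt_of_notMem x u h]
      exact hn.1 j
  · have h0 := hn.2.1 j hj
    rw [fillWt_of_notMem x u (fun h => ?_), h0]
    have := x.mem_half_iff.1 h
    norm_num [h0] at this
  · obtain ⟨j, hj⟩ := hn.2.2
    refine ⟨j, ?_⟩
    rw [fillWt_of_notMem x u (fun h => ?_), hj]
    have := x.mem_half_iff.1 h
    norm_num [hj] at this

/-- The characteristic map of a cell, lifted to the universal cover. -/
noncomputable def fill (u : Fin k → ℝ) : MilnorTotal G :=
  chi x.lift.lab ⟨x.fillWt u, x.fillWt_mem u x.lift.wt_mem.choose_spec⟩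

theorem fill_wt (u : Fin k → ℝ) : (x.fill u).wt = x.fillWt u := rfl

theorem fill_lab (u : Fin k → ℝ) {j : ℕ} (hj : x.fillWt u j ≠ 0) :
    (x.fill u).lab j = x.lift.lab j := MilnorTotal.chi_lab_of_ne _ _ hj

theorem continuous_fill : Continuous x.fill := by
  refine MilnorTotal.continuous_of_wt x.lift.wt_mem.choose x.lift.lab
    (fun u => (x.fillWt_mem u x.lift.wt_mem.choose_spec).2.1) (fun j => ?_) fun u j hj => x.fill_lab u hj
  simp only [fill_wt, fillWt]
  split_ifs <;> fun_prop

/-- The coordinates of a point in a closed cell. -/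
noncomputable def coord (y : MilnorBase G) (i : Fin k) : ℝ := 2 * y.wt (x.index i) - 1

theorem continuous_coord : Continuous x.coord :=
  continuous_pi fun _ => (continuous_const.mul (continuous_wt _)).sub continuous_const

/-- In a closed cell only the weights at the half indices are free: the others are forced to be `0`
or `1`, and the labels come from the barycenter. -/
theorem fill_coord {b : MilnorTotal G} (h : IsFace b x.lift) : x.fill (x.coord (proj b)) = b := by
  have hw : ∀ j, x.fillWt (x.coord (proj b)) j = b.wt j := by
    intro j
    by_cases hj : j ∈ half x.1
    · obtain ⟨i, rfl⟩ := x.exists_index hj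
      have h0 := b.wt_nonneg (x.index i)
      have h1 := b.wt_le_one (x.index i)
      rw [fillWt_index, coord, wt_proj, show (1 + (2 * b.wt (x.index i) - 1)) / 2 =
        b.wt (x.index i) by ring, min_eq_right h1, max_eq_right h0]
    · rw [fillWt_of_notMem x _ hj]
      rw [mem_half_iff] at hj
      rcases x.wt_cases j with h0 | h0 | h0
      · rw [h0, h.zero j h0]
      · rw [h0, h.one j h0]
      · exact absurd h0 hj
  refine MilnorTotal.ext' hw fun j hj => ?_
  rw [x.fill_lab _ hj, h.lab j (by rwa [← hw])]

theorem coord_mem_closedBall (y : MilnorBase G) : x.coord y ∈ Metric.closedBall (0 : Fin k → ℝ) 1 := by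
  obtain ⟨e, rfl⟩ := isOpenQuotientMap_proj.surjective y
  rw [mem_closedBall_zero_iff, pi_norm_le_iff_of_nonneg zero_le_one]
  intro i
  have h0 := e.wt_nonneg (x.index i)
  have h1 := e.wt_le_one (x.index i)
  rw [coord, wt_proj, Real.norm_eq_abs, abs_le]
  constructor <;> linarith

/-- A point that has a lift in the closed cell of some lift of `x` lies in the closed cell `x`. -/
theorem proj_fill_coord {b e : MilnorTotal G} (he : proj e = x.1) (h : IsFace b e) :
    proj (x.fill (x.coord (proj b))) = proj b := by
  obtain ⟨g, hg⟩ := proj_eq_iff.1 (x.proj_lift.trans he.symm)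
  have h1 : IsFace (g • b) x.lift := hg ▸ h.smul g
  have h2 : proj (g • b) = proj b := proj_eq_iff.2 ⟨g, rfl⟩
  rw [← h2, x.fill_coord h1]

theorem proj_fill_coord_of_round {y : MilnorBase G} (hy : round y = x.1) :
    proj (x.fill (x.coord y)) = y := by
  obtain ⟨e, rfl⟩ := isOpenQuotientMap_proj.surjective y
  exact x.proj_fill_coord hy e.isFace_round

theorem fillWt_index_cases {u : Fin k → ℝ} (hu : u ∈ Metric.closedBall (0 : Fin k → ℝ) 1)
    (i : Fin k) : x.fillWt u (x.index i) = (1 + u i) / 2 := by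
  rw [mem_closedBall_zero_iff, pi_norm_le_iff_of_nonneg zero_le_one] at hu
  have := abs_le.1 (hu i)
  rw [fillWt_index, min_eq_right (by linarith), max_eq_right (by linarith)]

theorem coord_fill {u : Fin k → ℝ} (hu : u ∈ Metric.closedBall (0 : Fin k → ℝ) 1) :
    x.coord (proj (x.fill u)) = u := by
  funext i
  rw [coord, wt_proj, fill_wt, x.fillWt_index_cases hu]
  ring

theorem round_fill {u : Fin k → ℝ} (hu : u ∈ Metric.ball (0 : Fin k → ℝ) 1) :
    (x.fill u).round = x.lift := by
  have hw : ∀ j, roundHalf (x.fillWt u j) = x.lift.wt j := by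
    intro j
    by_cases hj : j ∈ half x.1
    · rw [x.mem_half_iff.1 hj]
      obtain ⟨i, rfl⟩ := x.exists_index hj
      rw [x.fillWt_index_cases (Metric.ball_subset_closedBall hu), roundHalf_eq_half]
      rw [mem_ball_zero_iff, pi_norm_lt_iff zero_lt_one] at hu
      have := abs_lt.1 (hu i)
      constructor <;> intro h <;> linarith
    · rw [fillWt_of_notMem x _ hj]
      rw [mem_half_iff] at hj
      rcases x.wt_cases j with h0 | h0 | h0
      · rw [h0, roundHalf_eq_zero]
      · rw [h0, roundHalf_eq_one]
      · exact absurd h0 hj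
  refine MilnorTotal.ext' hw fun j hj => ?_
  exact x.fill_lab u fun h0 => hj (roundHalf_eq_zero.2 h0)

theorem coord_mem_ball {y : MilnorBase G} (hy : round y = x.1) :
    x.coord y ∈ Metric.ball (0 : Fin k → ℝ) 1 := by
  rw [mem_ball_zero_iff, pi_norm_lt_iff zero_lt_one]
  intro i
  have h := mem_half.1 (x.index_mem i)
  rw [← hy, round_wt, roundHalf_eq_half] at h
  obtain ⟨e, rfl⟩ := isOpenQuotientMap_proj.surjective y
  have h0 := lt_of_le_of_ne (e.wt_nonneg (x.index i)) h.1.symm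
  have h1 := lt_of_le_of_ne (e.wt_le_one (x.index i)) h.2
  rw [coord, wt_proj, Real.norm_eq_abs, abs_lt]
  constructor <;> linarith

/-- The characteristic map of a cell. -/
noncomputable def map : PartialEquiv (Fin k → ℝ) (MilnorBase G) where
  toFun u := proj (x.fill u)
  invFun := x.coord
  source := Metric.ball 0 1
  target := {y | round y = x.1}
  map_source' u hu := by
    change round (proj _) = _
    rw [round_proj, x.round_fill hu, x.proj_lift]
  map_target' y hy := x.coord_mem_ball hy
  left_inv' u hu := x.coord_fill (Metric.ball_subset_closedBall hu)
  right_inv' y hy := x.proj_fill_coord_of_round hy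

theorem map_apply (u : Fin k → ℝ) : x.map u = proj (x.fill u) := rfl

/-- The vertices, midpoints of edges, etc. of the unit cube. -/
def cubeCenters (k : ℕ) : Set (Fin k → ℝ) := Set.univ.pi fun _ => {-1, 0, 1}

theorem finite_cubeCenters (k : ℕ) : (cubeCenters k).Finite := Set.Finite.pi fun _ => by simp

/-- This is closure finiteness: an open cell that meets a closed cell has its barycenter at one of
the finitely many points with coordinates in `{-1, 0, 1}`. -/
theorem round_map_mem (u : Fin k → ℝ) :
    round (x.map u) ∈ x.map '' cubeCenters k := by
  have hcub : x.coord (round (x.map u)) ∈ cubeCenters k := by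
    intro i _
    rw [coord, round_wt]
    rcases roundHalf_cases ((x.map u).wt (x.index i)) with h | h | h <;> rw [h] <;> norm_num
  refine ⟨_, hcub, ?_⟩
  rw [map_apply, map_apply, round_proj]
  refine x.proj_fill_coord x.proj_lift ⟨fun j hj => ?_, fun j hj => ?_, fun j hj => ?_⟩
  · refine roundHalf_eq_zero.2 ((x.fillWt_of_notMem u fun h => ?_).trans hj)
    rw [mem_half_iff, hj] at h
    norm_num at h
  · refine roundHalf_eq_one.2 ((x.fillWt_of_notMem u fun h => ?_).trans hj)
    rw [mem_half_iff, hj] at h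
    norm_num at h
  · exact x.fill_lab u fun h => hj (roundHalf_eq_zero.2 h)

/-- On the sphere of the sup norm some coordinate is `±1`, so its weight is `0` or `1` and one half
index is lost; no new one can appear. -/
theorem card_half_round_map_lt {u : Fin k → ℝ} (hu : u ∈ Metric.sphere (0 : Fin k → ℝ) 1) :
    (half (round (x.map u))).card < k := by
  have hcb := Metric.sphere_subset_closedBall hu
  have hsub : half (round (x.map u)) ⊆ half x.1 := by
    intro j hj
    by_contra hj'
    rw [mem_half, round_wt, roundHalf_eq_half, map_apply, wt_proj, fill_wt,
      x.fillWt_of_notMem u hj'] at hj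
    rw [mem_half_iff] at hj'
    rcases x.wt_cases j with h | h | h
    · exact hj.1 h
    · exact hj.2 h
    · exact hj' h
  obtain ⟨i, hi⟩ : ∃ i, 1 ≤ |u i| := by
    by_contra! h
    rw [mem_sphere_zero_iff_norm] at hu
    exact hu.not_lt ((pi_norm_lt_iff zero_lt_one).2 h)
  conv_rhs => rw [← x.2.2]
  refine Finset.card_lt_card (hsub.ssubset_of_mem_notMem (x.index_mem i) fun hmem => ?_)
  rw [Finset.mem_coe, mem_half, round_wt, roundHalf_eq_half, map_apply, wt_proj, fill_wt,
    x.fillWt_index_cases hcb] at hmem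
  rw [mem_closedBall_zero_iff, pi_norm_le_iff_of_nonneg zero_le_one] at hcb
  have h1 : |u i| = 1 := le_antisymm (hcb i) hi
  rcases (abs_eq zero_le_one).1 h1 with h | h
  · exact hmem.2 (by rw [h]; norm_num)
  · exact hmem.1 (by rw [h]; norm_num)

end Cell

theorem mem_map_cellOf (y : MilnorBase G) : y ∈ (cellOf y).map '' Metric.closedBall 0 1 :=
  ⟨_, (cellOf y).coord_mem_closedBall y, (cellOf y).proj_fill_coord_of_round rfl⟩

theorem mem_openCell_cellOf (y : MilnorBase G) : y ∈ (cellOf y).map '' Metric.ball 0 1 :=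
  ⟨_, (cellOf y).coord_mem_ball rfl, (cellOf y).proj_fill_coord_of_round rfl⟩

open Classical in
/-- The weights of the barycenter of the face `t a = 1` of `maxSimplex n`. -/
noncomputable def faceWt (n a : ℕ) (j : ℕ) : ℝ := if j = a then 1 else if j < n then 1 / 2 else 0

theorem faceWt_mem {n a : ℕ} (ha : a < n) : faceWt n a ∈ maxSimplex n := by
  refine ⟨fun j => ?_, fun j hj => ?_, a, by simp [faceWt]⟩
  · unfold faceWt; split_ifs <;> norm_num
  · rw [faceWt, if_neg (by omega), if_neg (by omega)]

/-- The set `maxSimplex n` is the union of its finitely many faces `t a = 1` with `a < n`, and `chi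
g` maps each of them into one closed cube, the one with barycenter `faceWt n a`. -/
theorem isClosed_of_cells {A : Set (MilnorBase G)}
    (hA : ∀ k (x : Cell G k), IsClosed (A ∩ x.map '' Metric.closedBall 0 1)) : IsClosed A := by
  refine isOpenQuotientMap_proj.isQuotientMap.isClosed_preimage.1 (MilnorTotal.isClosed_iff.2 ?_)
  intro n g
  have key : ∀ a (ha : a < n), ∃ k, ∃ x : Cell G k, ∀ t : maxSimplex n, t.1 a = 1 →
      proj (chi g t) ∈ x.map '' Metric.closedBall 0 1 := by
    intro a ha
    let e : MilnorTotal G := chi g ⟨faceWt n a, faceWt_mem ha⟩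
    refine ⟨_, ⟨proj e, fun j => ?_, rfl⟩, fun t ht =>
      ⟨_, Cell.coord_mem_closedBall _ (proj (chi g t)),
        Cell.proj_fill_coord _ (e := e) rfl ⟨fun j hj => ?_, fun j hj => ?_, fun j hj => ?_⟩⟩⟩
    · change faceWt n a j = 0 ∨ faceWt n a j = 1 ∨ faceWt n a j = 1 / 2
      unfold faceWt; split_ifs <;> simp
    · refine t.2.2.1 j ?_
      by_contra h
      change faceWt n a j = 0 at hj
      rw [faceWt, if_pos (by omega : j < n)] at hj
      split_ifs at hj <;> norm_num at hj
    · change faceWt n a j = 1 at hj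
      unfold faceWt at hj
      split_ifs at hj with h1 h2
      · rw [h1]; exact ht
      · norm_num at hj
      · norm_num at hj
    · have hjn : j < n := by
        by_contra h
        exact hj (t.2.2.1 j (by omega))
      rw [MilnorTotal.chi_lab_of_ne g t hj, MilnorTotal.chi_lab_of_ne]
      change faceWt n a j ≠ 0
      unfold faceWt
      split_ifs <;> norm_num
  have hcl : IsClosed (⋃ a ∈ {a | a < n}, {t : maxSimplex n | t.1 a = 1 ∧ proj (chi g t) ∈ A}) := by
    refine (Set.finite_lt_nat n).isClosed_biUnion fun a ha => ?_
    obtain ⟨k, x, hx⟩ := key a ha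
    have : {t : maxSimplex n | t.1 a = 1 ∧ proj (chi g t) ∈ A} = {t : maxSimplex n | t.1 a = 1} ∩
        (fun t => proj (chi g t)) ⁻¹' (A ∩ x.map '' Metric.closedBall 0 1) := by
      ext t
      exact ⟨fun h => ⟨h.1, h.2, hx t h.1⟩, fun h => ⟨h.1, h.2.1⟩⟩
    rw [this]
    exact (isClosed_eq ((continuous_apply a).comp continuous_subtype_val) continuous_const).inter
      ((hA k x).preimage (continuous_proj.comp (MilnorTotal.continuous_chi g)))
  convert hcl using 1
  ext t
  simp only [Set.mem_iUnion]
  refine ⟨fun h => ?_, fun ⟨a, _, h⟩ => h.2⟩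
  obtain ⟨a, ha⟩ := t.2.2.2
  refine ⟨a, ?_, ha, h⟩
  by_contra h'
  have := t.2.2.1 a (by simpa using h')
  rw [ha] at this
  norm_num at this

/-- The open cells are the fibers of `round`, which makes them disjoint. Balls and spheres of `Fin k
→ ℝ` are those of the sup norm, so cubes serve directly as cells. -/
noncomputable instance : Topology.CWComplex (Set.univ : Set (MilnorBase G)) where
  cell := Cell G
  map _ x := x.map
  source_eq _ _ := rfl
  continuousOn _ x := (continuous_proj.comp x.continuous_fill).continuousOn
  continuousOn_symm _ x := x.continuous_coord.continuousOn
  pairwiseDisjoint' := by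
    rintro ⟨k, x⟩ - ⟨k', x'⟩ - hne
    refine Set.disjoint_left.2 ?_
    rintro y ⟨u, hu, rfl⟩ ⟨u', hu', huu⟩
    have h1 : round (x.map u) = x.1 := x.map.map_source hu
    have h2 : round (x'.map u') = x'.1 := x'.map.map_source hu'
    dsimp only at huu
    rw [huu, h1] at h2
    refine hne ?_
    obtain rfl : k = k' := by rw [← x.2.2, ← x'.2.2, h2]
    rw [Subtype.ext h2]
  mapsTo' k x := by
    have hfin : ∀ m, {c : Cell G m | c.1 ∈ x.map '' Cell.cubeCenters k}.Finite := fun m =>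
      ((Cell.finite_cubeCenters k).image x.map).preimage Subtype.val_injective.injOn
    refine ⟨fun m => (hfin m).toFinset, fun u hu => ?_⟩
    simp only [Set.mem_iUnion]
    refine ⟨_, x.card_half_round_map_lt hu, cellOf (x.map u), ?_, mem_map_cellOf _⟩
    rw [Set.Finite.mem_toFinset]
    exact x.round_map_mem u
  closed' _ _ h := isClosed_of_cells h
  union' := by
    refine Set.eq_univ_of_forall fun y => ?_
    simp only [Set.mem_iUnion]
    exact ⟨_, cellOf y, mem_map_cellOf y⟩

/-- A point whose support has at most `n` elements lies in the skeleton of dimension less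
than `n`. -/
theorem mem_skeletonLT {n : ℕ} {y : MilnorBase G} (h : {j | y.wt j ≠ 0}.encard ≤ n) :
    y ∈ (Topology.RelCWComplex.skeletonLT (Set.univ : Set (MilnorBase G)) (n : ℕ∞) :
      Set (MilnorBase G)) := by
  have hlt : (half (round y)).card < n := by
    obtain ⟨e, rfl⟩ := isOpenQuotientMap_proj.surjective y
    obtain ⟨a, ha⟩ := e.exists_wt_eq_one
    -- The index `a` of weight `1` lies in the support but is not a half index: this makes the
    -- dimension strictly less than the size of the support.
    have h1 : ((insert a (half (round (proj e))) : Finset ℕ) : Set ℕ) ⊆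
        {j | (proj e).wt j ≠ 0} := by
      intro j hj
      rw [Finset.mem_coe, Finset.mem_insert, mem_half, round_wt, roundHalf_eq_half] at hj
      rcases hj with rfl | hj
      · rw [Set.mem_ofPred_eq, wt_proj, ha]
        exact one_ne_zero
      · exact hj.1
    have h2 := (Set.encard_le_encard h1).trans h
    rw [Set.encard_coe_eq_coe_finsetCard, Finset.card_insert_of_notMem] at h2
    · exact_mod_cast h2
    · rw [mem_half, round_wt, roundHalf_eq_half]
      exact fun h => h.2 ha
  have hcell : y ∈ Topology.RelCWComplex.openCell (C := (Set.univ : Set (MilnorBase G))) _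
    (cellOf y) := mem_openCell_cellOf y
  exact Topology.RelCWComplex.skeletonLT_mono (by exact_mod_cast hlt)
    (Topology.RelCWComplex.openCell_subset_skeletonLT _ _ hcell)

end MilnorBase

/-! ### Calculus of path classes -/

namespace Path.Homotopic.Quotient

variable {X : Type*} [TopologicalSpace X] {x y z w : X}

theorem symm_trans_rev (a : Path.Homotopic.Quotient x y) (b : Path.Homotopic.Quotient y z) :
    (a.trans b).symm = b.symm.trans a.symm := by
  induction a using Quotient.ind with | mk a =>
  induction b using Quotient.ind with | mk b =>
  simp only [← mk_trans, ← mk_symm, Path.trans_symm]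

theorem symm_symm' (a : Path.Homotopic.Quotient x y) : a.symm.symm = a := by
  induction a using Quotient.ind with | mk a =>
  simp only [← mk_symm, Path.symm_symm]

theorem trans_left_cancel (a : Path.Homotopic.Quotient x y) {b c : Path.Homotopic.Quotient y z}
    (h : a.trans b = a.trans c) : b = c := by
  have := congrArg (a.symm.trans ·) h
  simpa only [← trans_assoc, symm_trans, refl_trans] using this

theorem trans_symm_trans (a : Path.Homotopic.Quotient x y) (b : Path.Homotopic.Quotient x z) :
    a.trans (a.symm.trans b) = b := by rw [← trans_assoc, trans_symm, refl_trans]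

theorem subpath_trans_subpath {a b : X} (γ : Path a b) (t₀ t₁ t₂ : I) :
    trans (mk (γ.subpath t₀ t₁)) (mk (γ.subpath t₁ t₂)) = mk (γ.subpath t₀ t₂) := by
  rw [← mk_trans, eq]
  exact ⟨Path.Homotopy.subpathTransSubpath γ t₀ t₁ t₂⟩

theorem cast_trans_cast {x' y' z' : X} (a : Path.Homotopic.Quotient x y)
    (b : Path.Homotopic.Quotient y z) (hx : x' = x) (hy : y' = y) (hz : z' = z) :
    (a.cast hx hy).trans (b.cast hy hz) = (a.trans b).cast hx hz := by
  subst hx hy hz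
  simp

end Path.Homotopic.Quotient

theorem Path.eventually_subpath_mem {X : Type*} [TopologicalSpace X] {a b : X} (γ : Path a b)
    {t : I} {V : Set X} (hV : V ∈ 𝓝 (γ t)) : ∀ᶠ t' in 𝓝 t, ∀ r, γ.subpath t t' r ∈ V := by
  obtain ⟨ε, hε, hεV⟩ := Metric.mem_nhds_iff.1 (γ.continuous.continuousAt hV)
  filter_upwards [Metric.ball_mem_nhds t hε] with t' ht' r
  have hr : γ.subpath t t' r ∈ Set.range (γ.subpath t t') := ⟨r, rfl⟩
  rw [Path.range_subpath] at hr
  obtain ⟨q, hq, hqr⟩ := hr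
  rw [← hqr]
  refine hεV ?_
  rw [Metric.mem_ball, Subtype.dist_eq, dist_comm] at ht' ⊢
  refine (Real.dist_left_le_of_mem_uIcc ?_).trans_lt ht'
  rcases Set.mem_uIcc.1 hq with h | h
  · exact Set.mem_uIcc.2 (Or.inl h)
  · exact Set.mem_uIcc.2 (Or.inr h)

/-! ### The classifying map of a cover and its effect on fundamental groups -/

/-- A finite open cover `U` of `X` with bump functions `ψ` and, for every member of the cover, a
choice of homotopy classes of paths from `x₀` that is compatible with paths in this member. -/
structure PathClassCover (X : Type u) [TopologicalSpace X] (x₀ : X) where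
  N : ℕ
  U : ℕ → Set X
  isOpen_U : ∀ j, IsOpen (U j)
  cls : ∀ (_ : ℕ) (x : X), Path.Homotopic.Quotient x₀ x
  cls_trans : ∀ j {x y : X} (w : Path x y), (∀ t, w t ∈ U j) →
    (cls j x).trans (.mk w) = cls j y
  ψ : ℕ → C(X, ℝ)
  ψ_mem : ∀ x, (fun j => ψ j x) ∈ maxSimplex N
  tsupport_ψ : ∀ j, tsupport (ψ j) ⊆ U j

namespace PathClassCover

variable {X : Type u} [TopologicalSpace X] {x₀ : X} (𝒞 : PathClassCover X x₀)

/-- The value at a homotopy class of paths from `x₀` of the classifying map of the universal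
cover. -/
noncomputable def point (x : X) (c : Path.Homotopic.Quotient x₀ x) :
    MilnorTotal (FundamentalGroup X x₀) :=
  MilnorTotal.chi (fun j => FundamentalGroup.fromPath ((𝒞.cls j x).trans c.symm))
    ⟨fun j => 𝒞.ψ j x, 𝒞.ψ_mem x⟩

theorem point_lab {x : X} (c : Path.Homotopic.Quotient x₀ x) {j : ℕ} (hj : 𝒞.ψ j x ≠ 0) :
    (𝒞.point x c).lab j = FundamentalGroup.fromPath ((𝒞.cls j x).trans c.symm) :=
  MilnorTotal.chi_lab_of_ne _ _ hj

/-- Equivariance. Multiplication in `FundamentalGroup` concatenates in reverse order, so appending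
`g⁻¹` to a label loop is left multiplication by `g⁻¹`. -/
theorem point_trans {x : X} (g : FundamentalGroup X x₀) (c : Path.Homotopic.Quotient x₀ x) :
    𝒞.point x (g.toPath.trans c) = g⁻¹ • 𝒞.point x c := by
  refine MilnorTotal.ext' (fun _ => rfl) fun j hj => ?_
  rw [MilnorTotal.smul_lab g⁻¹ (𝒞.point x c) hj, 𝒞.point_lab c hj, 𝒞.point_lab _ hj,
    FundamentalGroup.mul_def, FundamentalGroup.inv_def, Path.Homotopic.Quotient.symm_trans_rev]
  exact (Path.Homotopic.Quotient.trans_assoc _ _ _).symm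

/-- Some bump function is `1` at `x`; the label at its index is visible and determines the class. -/
theorem point_injective (x : X) : Function.Injective (𝒞.point x) := by
  intro c c' h
  obtain ⟨j, hj⟩ := (𝒞.ψ_mem x).2.2
  have hj0 : 𝒞.ψ j x ≠ 0 := by
    have hj' : 𝒞.ψ j x = 1 := hj
    simp [hj']
  have hl : (𝒞.point x c).lab j = (𝒞.point x c').lab j := by rw [h]
  rw [𝒞.point_lab c hj0, 𝒞.point_lab c' hj0] at hl
  have h2 := Path.Homotopic.Quotient.trans_left_cancel _ hl
  rw [← c.symm_symm', h2, c'.symm_symm']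

theorem point_cast {x y : X} (h : y = x) (c : Path.Homotopic.Quotient x₀ x) :
    𝒞.point y (c.cast rfl h) = 𝒞.point x c := by
  subst h
  simp

/-- Near a point the classifying map of the universal cover is given by the bump functions and
constant labels. -/
theorem exists_local_section (x : X) (c : Path.Homotopic.Quotient x₀ x) :
    ∃ V ∈ 𝓝 x, ∃ s : X → MilnorTotal (FundamentalGroup X x₀), Continuous s ∧
      ∀ y (w : Path x y), (∀ t, w t ∈ V) → 𝒞.point y (c.trans (.mk w)) = s y := by
  classical
  -- If `x ∉ U j`, the neighborhood avoids the support of `ψ j` and the label never matters. If `x ∈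
  -- U j`, paths stay in `U j`, so `cls_trans` keeps the label constant.
  let W : ℕ → Set X := fun j => if x ∈ 𝒞.U j then 𝒞.U j else (tsupport (𝒞.ψ j))ᶜ
  have hW : ∀ j, W j ∈ 𝓝 x := by
    intro j
    simp only [W]
    split_ifs with h
    · exact (𝒞.isOpen_U j).mem_nhds h
    · exact (isClosed_tsupport _).isOpen_compl.mem_nhds fun h' => h (𝒞.tsupport_ψ j h')
  let g : ℕ → FundamentalGroup X x₀ := fun j => .fromPath ((𝒞.cls j x).trans c.symm)
  refine ⟨⋂ j ∈ Finset.range 𝒞.N, W j, (Filter.biInter_finset_mem _).2 fun j _ => hW j,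
    fun y => MilnorTotal.chi g ⟨fun j => 𝒞.ψ j y, 𝒞.ψ_mem y⟩,
    (MilnorTotal.continuous_chi g).comp (Continuous.subtype_mk (by fun_prop) _), fun y w hw => ?_⟩
  refine MilnorTotal.chi_eq_chi rfl fun j hj => ?_
  have hj' : 𝒞.ψ j y ≠ 0 := hj
  have hjN : j ∈ Finset.range 𝒞.N := by
    by_contra h
    exact hj ((𝒞.ψ_mem y).2.1 j (by simpa using h))
  have hwW : ∀ t, w t ∈ W j := fun t => Set.mem_iInter₂.1 (hw t) j hjN
  have hx : x ∈ 𝒞.U j := by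
    by_contra h
    have h1 := hwW 1
    simp only [W, if_neg h, w.target] at h1
    exact h1 (subset_tsupport _ hj')
  have hwU : ∀ t, w t ∈ 𝒞.U j := fun t => by simpa only [W, if_pos hx] using hwW t
  have h := 𝒞.cls_trans j w hwU
  simp only [g]
  rw [← h, Path.Homotopic.Quotient.symm_trans_rev, Path.Homotopic.Quotient.trans_assoc,
    Path.Homotopic.Quotient.trans_symm_trans]

/-- The lift of a path to the universal cover of the classifying space. -/
theorem exists_lift {x y : X} (γ : Path x y) (c : Path.Homotopic.Quotient x₀ x) :
    ∃ Γ : Path (𝒞.point x c) (𝒞.point y (c.trans (.mk γ))),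
      ∀ t, ∃ c', Γ t = 𝒞.point (γ t) c' := by
  let c₀ : Path.Homotopic.Quotient x₀ (γ 0) := c.cast rfl γ.source
  -- The lift at time `t` appends the part of `γ` run so far; it is continuous because it agrees
  -- with a local section near each `t`.
  let φ : I → MilnorTotal (FundamentalGroup X x₀) := fun t =>
    𝒞.point (γ t) (c₀.trans (.mk (γ.subpath 0 t)))
  have hφ : Continuous φ := by
    refine continuous_iff_continuousAt.2 fun t => ?_
    obtain ⟨V, hV, s, hs, hsV⟩ := 𝒞.exists_local_section (γ t) (c₀.trans (.mk (γ.subpath 0 t)))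
    have heq : φ =ᶠ[𝓝 t] s ∘ γ := by
      filter_upwards [γ.eventually_subpath_mem hV] with t' ht'
      have h1 := hsV (γ t') (γ.subpath t t') ht'
      rw [Path.Homotopic.Quotient.trans_assoc,
        Path.Homotopic.Quotient.subpath_trans_subpath] at h1
      exact h1
    exact ((hs.comp γ.continuous).continuousAt).congr heq.symm
  refine ⟨⟨⟨φ, hφ⟩, ?_, ?_⟩, fun t => ⟨_, rfl⟩⟩
  · change 𝒞.point (γ 0) (c₀.trans (.mk (γ.subpath 0 0))) = _
    rw [Path.subpath_self, Path.Homotopic.Quotient.mk_refl, Path.Homotopic.Quotient.trans_refl,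
      𝒞.point_cast]
  · change 𝒞.point (γ 1) (c₀.trans (.mk (γ.subpath 0 1))) = _
    rw [Path.subpath_zero_one, Path.Homotopic.Quotient.mk_cast,
      Path.Homotopic.Quotient.cast_trans_cast, 𝒞.point_cast]

variable [PathConnectedSpace X]

/-- The classifying map, as a function. -/
noncomputable def classify (x : X) : MilnorBase (FundamentalGroup X x₀) :=
  MilnorBase.proj (𝒞.point x (.mk (PathConnectedSpace.somePath x₀ x)))

/-- Two classes of paths to `x` differ by a loop at `x₀`, so their points lie in one orbit. -/
theorem classify_eq (x : X) (c : Path.Homotopic.Quotient x₀ x) :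
    𝒞.classify x = MilnorBase.proj (𝒞.point x c) := by
  let d : Path.Homotopic.Quotient x₀ x := .mk (PathConnectedSpace.somePath x₀ x)
  have hc : 𝒞.point x c = (FundamentalGroup.fromPath (c.trans d.symm))⁻¹ • 𝒞.point x d := by
    rw [← 𝒞.point_trans]
    congr 1
    change c = (c.trans d.symm).trans d
    rw [Path.Homotopic.Quotient.trans_assoc, Path.Homotopic.Quotient.symm_trans,
      Path.Homotopic.Quotient.trans_refl]
  exact MilnorBase.proj_eq_iff.2 ⟨FundamentalGroup.fromPath (c.trans d.symm), by
    rw [hc, smul_inv_smul]⟩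

theorem continuous_classify [LocallyPathConnectedSpace X] : Continuous 𝒞.classify := by
  refine continuous_iff_continuousAt.2 fun x => ?_
  obtain ⟨V, hV, s, hs, hsV⟩ :=
    𝒞.exists_local_section x (.mk (PathConnectedSpace.somePath x₀ x))
  obtain ⟨W, ⟨hW, hWc⟩, hWV⟩ := (path_connected_basis x).mem_iff.1 hV
  refine ((MilnorBase.continuous_proj.comp hs).continuousAt).congr ?_
  filter_upwards [hW] with y hy
  obtain ⟨w, hw⟩ := hWc.joinedIn x (mem_of_mem_nhds hW) y hy
  rw [𝒞.classify_eq y _, hsV y w fun t => hWV (hw t)]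
  rfl

variable [LocallyPathConnectedSpace X]

/-- The classifying map of a cover. -/
noncomputable def classifyMap : C(X, MilnorBase (FundamentalGroup X x₀)) :=
  ⟨𝒞.classify, 𝒞.continuous_classify⟩

/-- A class of paths, as a point of the fiber over the image of its end point. -/
noncomputable def fiberPoint (x : X) (c : Path.Homotopic.Quotient x₀ x) :
    (MilnorBase.proj : MilnorTotal (FundamentalGroup X x₀) → _) ⁻¹' {𝒞.classifyMap x} :=
  ⟨𝒞.point x c, (𝒞.classify_eq x c).symm⟩

/-- The lift from `exists_lift` covers the image of `γ`, so monodromy acts on path classes by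
appending `γ`. -/
theorem monodromy_map {x y : X} (γ : Path.Homotopic.Quotient x y)
    (c : Path.Homotopic.Quotient x₀ x) :
    MilnorBase.isQuotientCoveringMap_proj.isCoveringMap.monodromy (γ.map 𝒞.classifyMap)
      (𝒞.fiberPoint x c) = 𝒞.fiberPoint y (c.trans γ) := by
  induction γ using Path.Homotopic.Quotient.ind with | mk γ =>
  obtain ⟨Γ, hΓ⟩ : ∃ Γ : Path (𝒞.fiberPoint x c).1 (𝒞.fiberPoint y (c.trans (.mk γ))).1,
      ∀ t, ∃ c', Γ t = 𝒞.point (γ t) c' := 𝒞.exists_lift γ c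
  refine IsCoveringMap.monodromy_eq_of_map_eq _ (.mk Γ) ?_
  refine congrArg Path.Homotopic.Quotient.mk (Path.ext (funext fun t => ?_))
  obtain ⟨c', hc'⟩ := hΓ t
  change MilnorBase.proj (Γ t) = 𝒞.classify (γ t)
  rw [hc', 𝒞.classify_eq]

/-- Appending distinct loops to `c` gives distinct points of the fiber, whence injectivity. The
fiber is one orbit, so every monodromy translate of the base lift comes from a loop in `X`, whence
surjectivity. -/
theorem bijective_map (x : X) : Function.Bijective (FundamentalGroup.map 𝒞.classifyMap x) := by
  let c : Path.Homotopic.Quotient x₀ x := .mk (PathConnectedSpace.somePath x₀ x)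
  have hmap : ∀ γ : FundamentalGroup X x,
      MilnorBase.isQuotientCoveringMap_proj.isCoveringMap.monodromy
        (FundamentalGroup.map 𝒞.classifyMap x γ) (𝒞.fiberPoint x c) =
      𝒞.fiberPoint x (c.trans γ.toPath) := fun γ => 𝒞.monodromy_map γ.toPath c
  refine ⟨fun γ γ' h => ?_, fun κ => ?_⟩
  · have h1 := (hmap γ).symm.trans ((congrArg (fun κ =>
      MilnorBase.isQuotientCoveringMap_proj.isCoveringMap.monodromy κ (𝒞.fiberPoint x c)) h).trans
        (hmap γ'))
    exact Path.Homotopic.Quotient.trans_left_cancel c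
      (𝒞.point_injective x (congrArg Subtype.val h1))
  · let e := MilnorBase.isQuotientCoveringMap_proj.isCoveringMap.monodromy κ (𝒞.fiberPoint x c)
    obtain ⟨g, hg⟩ := MilnorBase.proj_eq_iff.1
      ((e.2 : MilnorBase.proj e.1 = _).trans (𝒞.classify_eq x c))
    have he : 𝒞.fiberPoint x ((g⁻¹ : FundamentalGroup X x₀).toPath.trans c) = e := by
      refine Subtype.ext ?_
      change 𝒞.point x _ = e.1
      rw [𝒞.point_trans, inv_inv, hg]
    refine ⟨FundamentalGroup.fromPath (c.symm.trans ((g⁻¹ : FundamentalGroup X x₀).toPath.trans c)),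
      ?_⟩
    -- A loop in the base is determined by its monodromy, and the monodromy by its value at one
    -- point of the fiber.
    refine MilnorBase.isQuotientCoveringMap_proj.monodromyPerm_injective (DFunLike.coe_injective ?_)
    refine MilnorBase.isQuotientCoveringMap_proj.monodromy_ext (𝒞.fiberPoint x c) ?_
    refine (hmap _).trans (Eq.trans ?_ he)
    congr 1
    exact Path.Homotopic.Quotient.trans_symm_trans _ _

theorem isEilenbergMacLaneOne (𝒞 : PathClassCover X x₀) (x : X) :
    IsEilenbergMacLaneOne (MilnorBase (FundamentalGroup X x₀)) (FundamentalGroup X x) where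
  pathConnected := inferInstance
  fundamentalGroup y :=
    ⟨(FundamentalGroup.fundamentalGroupMulEquivOfPathConnected y (𝒞.classifyMap x)).trans
      (MulEquiv.ofBijective _ (𝒞.bijective_map x)).symm⟩
  higher_trivial y k hk := MilnorBase.subsingleton_homotopyGroup y k hk

/-- An essential space has no good cover of small multiplicity. -/
theorem exists_lt_encard {n : ℕ} (hess : IsEssential X n) :
    ∃ x, (n : ℕ∞) < {j | 𝒞.ψ j x ≠ 0}.encard := by
  by_contra! h
  refine hess _ 𝒞.isEilenbergMacLaneOne 𝒞.classifyMap 𝒞.bijective_map ?_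
  rintro _ ⟨x, rfl⟩
  exact MilnorBase.mem_skeletonLT (h x)

end PathClassCover

/-! ### Local topology of polyhedra -/

section Polyhedron

variable {N : ℕ} {K : Geometry.SimplicialComplex ℝ (EuclideanSpace ℝ (Fin N))}

theorem isClosed_convexHull_face (s : Finset (EuclideanSpace ℝ (Fin N))) :
    IsClosed (convexHull ℝ (s : Set (EuclideanSpace ℝ (Fin N)))) :=
  s.finite_toSet.isClosed_convexHull (𝕜 := ℝ)

theorem Geometry.SimplicialComplex.isCompact_space (hK : K.faces.Finite) : IsCompact K.space :=
  hK.isCompact_biUnion fun s _ => s.finite_toSet.isCompact_convexHull (𝕜 := ℝ)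

/-- Small balls in a finite simplicial complex are star-shaped. -/
theorem Geometry.SimplicialComplex.exists_starConvex (hK : K.faces.Finite)
    (x : EuclideanSpace ℝ (Fin N)) :
    ∃ ε > 0, StarConvex ℝ x (Metric.ball x ε ∩ K.space) := by
  -- The ball avoids every closed face not containing `x`; so any face through a point of the ball
  -- contains `x` and the segment back to it.
  have hU : (⋂ s ∈ {s ∈ K.faces | x ∉ convexHull ℝ (s : Set (EuclideanSpace ℝ (Fin N)))},
      (convexHull ℝ (s : Set (EuclideanSpace ℝ (Fin N))))ᶜ) ∈ 𝓝 x :=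
    (Filter.biInter_mem (hK.subset fun _ h => h.1)).2 fun s hs =>
      (isClosed_convexHull_face s).isOpen_compl.mem_nhds hs.2
  obtain ⟨ε, hε, hεU⟩ := Metric.mem_nhds_iff.1 hU
  refine ⟨ε, hε, fun z hz a b ha hb hab => ?_⟩
  obtain ⟨hzb, hzK⟩ := hz
  obtain ⟨s, hs, hzs⟩ := Set.mem_iUnion₂.1 hzK
  have hxs : x ∈ convexHull ℝ (s : Set (EuclideanSpace ℝ (Fin N))) := by
    by_contra h
    exact Set.mem_iInter₂.1 (hεU hzb) s ⟨hs, h⟩ hzs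
  exact ⟨convex_ball x ε (Metric.mem_ball_self hε) hzb ha hb hab,
    Set.mem_iUnion₂.2 ⟨s, hs, convex_convexHull ℝ _ hxs hzs ha hb hab⟩⟩

end Polyhedron

/-- A loop inside the image of a simply connected space is nullhomotopic. -/
theorem Path.homotopic_refl_of_lift {X Z : Type*} [TopologicalSpace X] [TopologicalSpace Z]
    [SimplyConnectedSpace Z] {f : Z → X} (hf : Continuous f) {y : X} (γ : Path y y) (g : I → Z)
    (hg : Continuous g) (h01 : g 0 = g 1) (hfg : ∀ t, f (g t) = γ t) :
    γ.Homotopic (Path.refl y) := by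
  obtain rfl : f (g 0) = y := by rw [hfg, γ.source]
  let Γ : Path (g 0) (g 0) := ⟨⟨g, hg⟩, rfl, h01.symm⟩
  have h := (SimplyConnectedSpace.paths_homotopic Γ (Path.refl _)).map ⟨f, hf⟩
  have e : Γ.map hf = γ := by
    ext t
    exact hfg t
  rw [← e]
  exact h

theorem IsCompactPolyhedron.compactSpace {X : Type u} [TopologicalSpace X] {n : ℕ}
    (hX : IsCompactPolyhedron X n) : CompactSpace X := by
  obtain ⟨N, K, hK, -, -, ⟨h⟩⟩ := hX
  have := isCompact_iff_compactSpace.1 (K.isCompact_space hK)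
  exact h.symm.compactSpace

theorem IsCompactPolyhedron.nonempty {X : Type u} [TopologicalSpace X] {n : ℕ}
    (hX : IsCompactPolyhedron X n) : Nonempty X := by
  obtain ⟨N, K, hK, -, ⟨s, hs, -⟩, ⟨h⟩⟩ := hX
  obtain ⟨v, hv⟩ := K.nonempty_of_mem_faces hs
  exact ⟨h.symm ⟨v, Set.mem_iUnion₂.2 ⟨s, hs, subset_convexHull ℝ _ hv⟩⟩⟩

/-- A polyhedron is semilocally simply connected. -/
theorem IsCompactPolyhedron.exists_nhds_nullhomotopic {X : Type u} [TopologicalSpace X] {n : ℕ}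
    (hX : IsCompactPolyhedron X n) (x : X) :
    ∃ V ∈ 𝓝 x, ∀ (y : X) (γ : Path y y), (∀ t, γ t ∈ V) → γ.Homotopic (Path.refl y) := by
  obtain ⟨N, K, hK, -, -, ⟨h⟩⟩ := hX
  obtain ⟨ε, hε, hstar⟩ := K.exists_starConvex hK (h x).1
  have hne : (Metric.ball (h x).1 ε ∩ K.space).Nonempty :=
    ⟨(h x).1, Metric.mem_ball_self hε, (h x).2⟩
  have : ContractibleSpace ↥(Metric.ball (h x).1 ε ∩ K.space) := hstar.contractibleSpace hne
  refine ⟨(fun z => (h z).1) ⁻¹' Metric.ball (h x).1 ε,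
    (continuous_subtype_val.comp h.continuous).continuousAt (Metric.ball_mem_nhds _ hε),
    fun y γ hγ => ?_⟩
  refine γ.homotopic_refl_of_lift
    (f := fun z : ↥(Metric.ball (h x).1 ε ∩ K.space) => h.symm ⟨z.1, z.2.2⟩)
    (h.symm.continuous.comp (continuous_subtype_val.subtype_mk _))
    (fun t => ⟨(h (γ t)).1, hγ t, (h (γ t)).2⟩) ?_ ?_ ?_
  · exact (continuous_subtype_val.comp (h.continuous.comp γ.continuous)).subtype_mk _
  · simp
  · intro t
    simp

/-! ### Short paths, the systole and compatible path classes -/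

section Length

variable {X : Type u} [PseudoEMetricSpace X] {x y z : X}

theorem edist_le_pathLength (γ : Path x y) (t : I) : edist x (γ t) ≤ pathLength γ := by
  simpa only [γ.source] using!
    eVariationOn.edist_le (fun t => γ t) (Set.mem_univ (0 : I)) (Set.mem_univ t)

theorem pathLength_symm_le (γ : Path x y) : pathLength γ.symm ≤ pathLength γ :=
  eVariationOn.comp_le_of_antitoneOn (fun t => γ t) σ
    (unitInterval.strictAnti_symm.antitone.antitoneOn _) (Set.mapsTo_univ _ _)

theorem pathLength_trans_le (γ : Path x y) (γ' : Path y z) :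
    pathLength (γ.trans γ') ≤ pathLength γ + pathLength γ' := by
  let h : I := ⟨1 / 2, by norm_num, by norm_num⟩
  have hu : (Set.univ : Set I) = Set.Iic h ∪ Set.Ici h := Set.Iic_union_Ici.symm
  rw [pathLength, hu, eVariationOn.union _ (x := h) isGreatest_Iic isLeast_Ici]
  refine add_le_add ?_ ?_
  · have he : Set.EqOn (fun t => (γ.trans γ') t)
        ((fun t => γ t) ∘ fun t : I => Set.projIcc (0 : ℝ) 1 zero_le_one (2 * t)) (Set.Iic h) := by
      intro t ht
      have ht' : (t : ℝ) ≤ 1 / 2 := ht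
      simp only [Path.trans_apply, dif_pos ht', Function.comp]
      rw [Set.projIcc_of_mem]
    rw [eVariationOn.congr he]
    refine eVariationOn.comp_le_of_monotoneOn _ _ (fun a _ b _ hab => ?_) (Set.mapsTo_univ _ _)
    exact Set.monotone_projIcc _ (by have : (a : ℝ) ≤ b := hab; linarith)
  · have he : Set.EqOn (fun t => (γ.trans γ') t)
        ((fun t => γ' t) ∘ fun t : I => Set.projIcc (0 : ℝ) 1 zero_le_one (2 * t - 1))
        (Set.Ici h) := by
      intro t ht
      have ht' : 1 / 2 ≤ (t : ℝ) := ht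
      have hm : 2 * (t : ℝ) - 1 ∈ I := ⟨by linarith, by linarith [t.2.2]⟩
      simp only [Path.trans_apply, Function.comp]
      rw [Set.projIcc_of_mem _ hm]
      split_ifs with h'
      · have h2 : (t : ℝ) = 1 / 2 := le_antisymm h' ht'
        have e1 : (⟨2 * (t : ℝ), (unitInterval.mul_pos_mem_iff zero_lt_two).2 ⟨t.2.1, h'⟩⟩ : I) = 1 :=
          Subtype.ext (by simp [h2])
        have e2 : (⟨2 * (t : ℝ) - 1, hm⟩ : I) = 0 := Subtype.ext (by simp [h2])
        rw [e1, e2, γ.target, γ'.source]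
      · rfl
    rw [eVariationOn.congr he]
    refine eVariationOn.comp_le_of_monotoneOn _ _ (fun a _ b _ hab => ?_) (Set.mapsTo_univ _ _)
    exact Set.monotone_projIcc _ (by have : (a : ℝ) ≤ b := hab; linarith)

theorem homotopic_refl_of_pathLength_lt_systole (γ : Path x x) (h : pathLength γ < systole X) :
    γ.Homotopic (Path.refl x) := by
  by_contra hγ
  exact h.not_ge (iInf_le_of_le x (iInf₂_le γ hγ))

theorem IsLengthSpace.exists_path (hX : IsLengthSpace X) {r : ℝ≥0∞} (h : edist x y < r) :
    ∃ γ : Path x y, pathLength γ < r := by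
  rw [hX x y] at h
  exact iInf_lt_iff.1 h

end Length

section LengthSpace

variable {X : Type u} [PseudoMetricSpace X]

theorem IsLengthSpace.pathConnectedSpace [Nonempty X] (hX : IsLengthSpace X) :
    PathConnectedSpace X where
  nonempty := inferInstance
  joined _ _ := (hX.exists_path (edist_lt_top _ _)).elim fun γ _ => ⟨γ⟩

theorem IsLengthSpace.exists_path_mem_ball (hX : IsLengthSpace X) {x y : X} {r : ℝ}
    (h : dist x y < r) :
    ∃ γ : Path x y, pathLength γ < ENNReal.ofReal r ∧ ∀ t, γ t ∈ Metric.ball x r := by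
  have hr : 0 < r := dist_nonneg.trans_lt h
  obtain ⟨γ, hγ⟩ := hX.exists_path (r := ENNReal.ofReal r)
    (by rw [edist_dist]; exact (ENNReal.ofReal_lt_ofReal_iff hr).2 h)
  refine ⟨γ, hγ, fun t => ?_⟩
  have h1 := (edist_le_pathLength γ t).trans_lt hγ
  rw [edist_dist, ENNReal.ofReal_lt_ofReal_iff hr] at h1
  rwa [Metric.mem_ball, dist_comm]

theorem IsLengthSpace.locallyPathConnectedSpace (hX : IsLengthSpace X) :
    LocallyPathConnectedSpace X :=
  .of_bases (fun x => Metric.nhds_basis_ball (x := x)) fun x r hr =>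
    ⟨x, Metric.mem_ball_self hr, fun {y} hy => by
      rw [Metric.mem_ball, dist_comm] at hy
      obtain ⟨γ, -, hγ⟩ := hX.exists_path_mem_ball hy
      exact ⟨γ, hγ⟩⟩

/-- In a compact semilocally simply connected space small loops are nullhomotopic. -/
theorem exists_pos_nullhomotopic [CompactSpace X]
    (h : ∀ x : X, ∃ V ∈ 𝓝 x, ∀ (y : X) (γ : Path y y), (∀ t, γ t ∈ V) →
      γ.Homotopic (Path.refl y)) :
    ∃ δ > 0, ∀ (x : X) (y : X) (γ : Path y y), (∀ t, γ t ∈ Metric.ball x δ) →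
      γ.Homotopic (Path.refl y) := by
  choose V hV hnull using h
  obtain ⟨δ, hδ, hcov⟩ := lebesgue_number_lemma_of_metric isCompact_univ
    (c := fun x => interior (V x)) (fun _ => isOpen_interior)
    (fun x _ => Set.mem_iUnion.2 ⟨x, mem_interior_iff_mem_nhds.2 (hV x)⟩)
  refine ⟨δ, hδ, fun x y γ hγ => ?_⟩
  obtain ⟨i, hi⟩ := hcov x (Set.mem_univ x)
  exact hnull i y γ fun t => interior_subset (hi (hγ t))

/-- If `2 r` is less than the systole, then the paths inside a closed ball of radius `r` are
determined up to homotopy by compatible classes of paths from the center. -/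
theorem IsLengthSpace.exists_classes (hX : IsLengthSpace X) [PathConnectedSpace X]
    (hsmall : ∃ δ > 0, ∀ (x : X) (y : X) (γ : Path y y), (∀ t, γ t ∈ Metric.ball x δ) →
      γ.Homotopic (Path.refl y)) {r : ℝ≥0} (hr : 2 * (r : ℝ≥0∞) < systole X) (p : X) :
    ∃ cls : ∀ x, Path.Homotopic.Quotient p x, ∀ {x y : X} (w : Path x y),
      (∀ t, w t ∈ Metric.closedBall p r) → (cls x).trans (.mk w) = cls y := by
  classical
  obtain ⟨δ, hδ, hnull⟩ := hsmall
  obtain ⟨R, hrR, hR⟩ : ∃ R : ℝ≥0, 2 * (r : ℝ≥0∞) < R ∧ (R : ℝ≥0∞) < systole X := by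
    exact ENNReal.lt_iff_exists_nnreal_btwn.1 hr
  have hrR' : 2 * (r : ℝ) < R := by exact_mod_cast hrR
  -- The loops below have length at most `(r + ε) + ε + (r + ε) = 2 r + 3 ε`, which is less than
  -- `R`.
  let ε : ℝ := (R - 2 * r) / 4
  have hε : 0 < ε := by simp only [ε]; linarith
  let Short : ∀ {x y : X}, Path x y → Prop := fun a => pathLength a < ENNReal.ofReal (r + ε)
  -- Points without a short path from `p` get an arbitrary class; none of them lies in the closed
  -- ball.
  let cls : ∀ x, Path.Homotopic.Quotient p x := fun x =>
    if h : ∃ a : Path p x, Short a then .mk h.choose else .mk (PathConnectedSpace.somePath p x)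
  have hcls : ∀ x ∈ Metric.closedBall p r, ∃ a : Path p x, Short a ∧ cls x = .mk a := by
    intro x hx
    have h : ∃ a : Path p x, Short a := by
      obtain ⟨γ, hγ, -⟩ := hX.exists_path_mem_ball (x := p) (y := x) (r := r + ε) (by
        rw [Metric.mem_closedBall, dist_comm] at hx
        linarith)
      exact ⟨γ, hγ⟩
    exact ⟨h.choose, h.choose_spec, dif_pos h⟩
  have step : ∀ {x y : X}, x ∈ Metric.closedBall p r → y ∈ Metric.closedBall p r →
      ∀ τ : Path x y, pathLength τ < ENNReal.ofReal ε →
        (cls x).trans (.mk τ) = cls y := by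
    intro x y hx hy τ hτ
    obtain ⟨a, ha, hax⟩ := hcls x hx
    obtain ⟨b, hb, hby⟩ := hcls y hy
    have hlen : pathLength ((a.trans τ).trans b.symm) < systole X := by
      refine lt_of_le_of_lt ?_ hR
      calc pathLength ((a.trans τ).trans b.symm)
          ≤ (pathLength a + pathLength τ) + pathLength b :=
            (pathLength_trans_le _ _).trans
              (add_le_add (pathLength_trans_le _ _) (pathLength_symm_le b))
        _ ≤ (ENNReal.ofReal (r + ε) + ENNReal.ofReal ε) + ENNReal.ofReal (r + ε) :=
            add_le_add (add_le_add ha.le hτ.le) hb.le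
        _ = ENNReal.ofReal ((r + ε + ε) + (r + ε)) := by
            have := r.coe_nonneg
            rw [← ENNReal.ofReal_add, ← ENNReal.ofReal_add] <;> linarith
        _ ≤ ENNReal.ofReal R := ENNReal.ofReal_le_ofReal (by simp only [ε]; linarith)
        _ = R := ENNReal.ofReal_coe_nnreal
    have hq := Path.Homotopic.Quotient.eq.2 (homotopic_refl_of_pathLength_lt_systole _ hlen)
    rw [Path.Homotopic.Quotient.mk_trans, Path.Homotopic.Quotient.mk_symm,
      Path.Homotopic.Quotient.mk_trans, Path.Homotopic.Quotient.mk_refl] at hq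
    have := congrArg (fun c => c.trans (Path.Homotopic.Quotient.mk b)) hq
    simp only [Path.Homotopic.Quotient.trans_assoc, Path.Homotopic.Quotient.symm_trans,
      Path.Homotopic.Quotient.trans_refl, Path.Homotopic.Quotient.refl_trans] at this
    rw [hax, hby, this]
  refine ⟨cls, fun {x y} w hw => ?_⟩
  -- The path `w` may have infinite length even on small intervals. A small piece of it is homotopic
  -- to a short path `τ`, since both stay in a ball whose loops are nullhomotopic, and `step`
  -- applies to `τ`.
  have hloc : ∀ t, ∀ᶠ t' in 𝓝 t, (cls (w t)).trans (.mk (w.subpath t t')) = cls (w t') := by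
    intro t
    have hm : 0 < min δ ε := lt_min hδ hε
    filter_upwards [w.eventually_subpath_mem (Metric.ball_mem_nhds (w t) hm)] with t' ht'
    obtain ⟨τ, hτ, hτb⟩ := hX.exists_path_mem_ball (x := w t) (y := w t') (r := min δ ε) (by
      have := ht' 1
      rwa [(w.subpath t t').target, Metric.mem_ball, dist_comm] at this)
    have hloop : ((w.subpath t t').trans τ.symm).Homotopic (Path.refl (w t)) := by
      refine hnull (w t) _ _ fun s => Metric.ball_subset_ball (min_le_left δ ε) ?_
      have hs : ((w.subpath t t').trans τ.symm) s ∈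
          Set.range ((w.subpath t t').trans τ.symm) := ⟨s, rfl⟩
      rw [Path.trans_range, Path.symm_range] at hs
      rcases hs with ⟨s', hs'⟩ | ⟨s', hs'⟩
      · exact hs' ▸ ht' s'
      · exact hs' ▸ hτb s'
    have hq := Path.Homotopic.Quotient.eq.2 hloop
    rw [Path.Homotopic.Quotient.mk_trans, Path.Homotopic.Quotient.mk_symm,
      Path.Homotopic.Quotient.mk_refl] at hq
    have := congrArg (fun c => c.trans (Path.Homotopic.Quotient.mk τ)) hq
    simp only [Path.Homotopic.Quotient.trans_assoc, Path.Homotopic.Quotient.symm_trans,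
      Path.Homotopic.Quotient.trans_refl, Path.Homotopic.Quotient.refl_trans] at this
    rw [this]
    exact step (hw t) (hw t') τ (hτ.trans_le (ENNReal.ofReal_le_ofReal (min_le_right _ _)))
  -- The truth value of `P` is locally constant, so connectedness of the interval carries it from
  -- `0` to `1`.
  let P : I → Prop := fun t => (cls (w 0)).trans (.mk (w.subpath 0 t)) = cls (w t)
  have hP : ∀ t, ∀ᶠ t' in 𝓝 t, (P t ↔ P t') := by
    intro t
    filter_upwards [hloc t] with t' ht'
    simp only [P]
    rw [← ht', ← Path.Homotopic.Quotient.subpath_trans_subpath w 0 t t',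
      ← Path.Homotopic.Quotient.trans_assoc]
    refine ⟨fun h => by rw [h], fun h => ?_⟩
    have := congrArg (fun c => c.trans (Path.Homotopic.Quotient.mk (w.subpath t t')).symm) h
    simpa only [Path.Homotopic.Quotient.trans_assoc, Path.Homotopic.Quotient.trans_symm,
      Path.Homotopic.Quotient.trans_refl] using this
  have hclopen : IsClopen {t | P t} := by
    refine ⟨⟨isOpen_iff_mem_nhds.2 fun t ht => ?_⟩, isOpen_iff_mem_nhds.2 fun t ht => ?_⟩
    · filter_upwards [hP t] with t' ht' h
      exact ht (ht'.2 h)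
    · filter_upwards [hP t] with t' ht'
      exact ht'.1 ht
  have h0 : P 0 := by
    simp only [P]
    rw [Path.subpath_self, Path.Homotopic.Quotient.mk_refl, Path.Homotopic.Quotient.trans_refl]
  have h1 : P 1 := by
    have := hclopen.eq_univ ⟨0, h0⟩
    exact Set.eq_univ_iff_forall.1 this 1
  simp only [P] at h1
  rw [Path.subpath_zero_one] at h1
  obtain ⟨w, rfl, rfl⟩ := w
  exact h1

end LengthSpace

/-! ### From a cover of small multiplicity to a contradiction -/

/-- If `2 r` is less than the systole, then an essential polyhedral length space has no open cover
of multiplicity at most `n` by subsets of balls of radius `r`. -/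
theorem not_exists_cover_of_lt_systole {X : Type u} [MetricSpace X] {n : ℕ}
    (hpoly : IsCompactPolyhedron X n) (hlen : IsLengthSpace X) (hess : IsEssential X n)
    {r : ℝ≥0} (hr : 2 * (r : ℝ≥0∞) < systole X) {𝒰 : Set (Set X)} (hcov : ⋃₀ 𝒰 = Set.univ)
    (hopen : ∀ U ∈ 𝒰, IsOpen U) (hball : ∀ U ∈ 𝒰, ∃ p : X, U ⊆ Metric.closedBall p r)
    (hmult : ∀ x : X, {U ∈ 𝒰 | x ∈ U}.encard ≤ n) : False := by
  have := hpoly.compactSpace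
  have := hpoly.nonempty
  have := hlen.pathConnectedSpace
  have := hlen.locallyPathConnectedSpace
  let x₀ : X := Classical.arbitrary X
  have hcls := hlen.exists_classes (exists_pos_nullhomotopic hpoly.exists_nhds_nullhomotopic) hr
  choose cls hcls using hcls
  obtain ⟨T, hT⟩ := isCompact_univ.elim_finite_subcover (fun U : 𝒰 => U.1)
    (fun U => hopen U.1 U.2) (by rw [← Set.sUnion_eq_iUnion, hcov])
  let U : ℕ → Set X := fun j => if h : j < T.card then (T.equivFin.symm ⟨j, h⟩).1.1 else ∅
  have hUmem : ∀ j < T.card, U j ∈ 𝒰 := fun j hj => by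
    simp only [U, dif_pos hj]
    exact (T.equivFin.symm ⟨j, hj⟩).1.2
  have hUempty : ∀ j, ¬ j < T.card → U j = ∅ := fun j hj => dif_neg hj
  have hUinj : Set.InjOn U {j | j < T.card} := by
    intro i hi j hj hij
    simp only [U, dif_pos (show i < T.card from hi), dif_pos (show j < T.card from hj)] at hij
    have := T.equivFin.symm.injective (Subtype.ext (Subtype.ext hij))
    exact congrArg Fin.val this
  have hUopen : ∀ j, IsOpen (U j) := fun j => by
    by_cases hj : j < T.card
    · exact hopen _ (hUmem j hj)
    · rw [hUempty j hj]; exact isOpen_empty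
  have hUcov : Set.univ ⊆ ⋃ j, U j := fun x hx => by
    obtain ⟨V, hV, hxV⟩ := Set.mem_iUnion₂.1 (hT hx)
    refine Set.mem_iUnion.2 ⟨T.equivFin ⟨V, hV⟩, ?_⟩
    simpa only [U, dif_pos (T.equivFin ⟨V, hV⟩).2, Fin.eta, Equiv.symm_apply_apply] using hxV
  -- At every point some function of a bump covering equals `1`, which is exactly the maximum
  -- normalization of the join.
  obtain ⟨f, hf⟩ := BumpCovering.exists_isSubordinate isClosed_univ U hUopen hUcov
  have hfU : ∀ j x, f j x ≠ 0 → x ∈ U j := fun j x h => hf j (subset_tsupport _ h)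
  have hfN : ∀ j x, f j x ≠ 0 → j < T.card := fun j x h => by
    by_contra hj
    have := hfU j x h
    rwa [hUempty j hj] at this
  have hcenter : ∀ j, ∃ p : X, U j ⊆ Metric.closedBall p r := fun j => by
    by_cases hj : j < T.card
    · exact hball _ (hUmem j hj)
    · exact ⟨x₀, by rw [hUempty j hj]; exact Set.empty_subset _⟩
  choose p hp using hcenter
  let 𝒞 : PathClassCover X x₀ :=
    { N := T.card
      U := U
      isOpen_U := hUopen
      -- All classes must start at `x₀`, so each is routed through the center of its ball.
      cls := fun j x => (Path.Homotopic.Quotient.mk (PathConnectedSpace.somePath x₀ (p j))).trans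
        (cls (p j) x)
      cls_trans := fun j x y w hw => by
        rw [Path.Homotopic.Quotient.trans_assoc, hcls (p j) w fun t => hp j (hw t)]
      ψ := f
      ψ_mem := fun x => ⟨fun j => ⟨f.nonneg j x, f.le_one j x⟩, fun j hj => by
        by_contra h
        exact absurd (hfN j x h) (not_lt.2 hj), _, f.ind_apply x (Set.mem_univ x)⟩
      tsupport_ψ := hf }
  obtain ⟨x, hx⟩ := 𝒞.exists_lt_encard hess
  -- Distinct indices name distinct members of `𝒰`, so the number of nonzero bump functions at `x`
  -- is at most the multiplicity there.
  refine hx.not_ge ((Set.encard_le_encard_of_injOn (f := U) (fun j hj => ?_) ?_).trans (hmult x))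
  · exact ⟨hUmem j (hfN j x hj), hfU j x hj⟩
  · exact hUinj.mono fun j hj => hfN j x hj

theorem mainTheorem5 (X : Type u) [MetricSpace X] (n : ℕ) (hn : 1 ≤ n)
    (hpoly : IsCompactPolyhedron X n) (hlen : IsLengthSpace X) (hess : IsEssential X n) :
    systole X ≤ 2 * alexandrovWidth X (n - 1) := by
  by_contra! h
  have h2 : alexandrovWidth X (n - 1) < systole X / 2 := by
    rw [ENNReal.lt_div_iff_mul_lt (by simp) (by simp), mul_comm]
    exact h
  obtain ⟨r, hr⟩ := iInf_lt_iff.1 h2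
  obtain ⟨⟨𝒰, hcov, hU, hmult⟩, hr⟩ := iInf_lt_iff.1 hr
  rw [ENNReal.lt_div_iff_mul_lt (by simp) (by simp), mul_comm] at hr
  -- The subtraction is truncated; `1 ≤ n` turns the multiplicity bound `(n - 1) + 1` into `n`.
  have hn' : ((n - 1 : ℕ) : ℕ∞) + 1 = n := by exact_mod_cast Nat.sub_add_cancel hn
  refine not_exists_cover_of_lt_systole hpoly hlen hess hr hcov (fun U h => (hU U h).1)
    (fun U h => (hU U h).2.2) fun x => ?_
  rw [← hn']
  exact hmult x
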